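/- Let $c\in(0,1)$, $\alpha\in(0,2]$ and $m=c^\alpha\in(0,1)$. For $t>0$ and $u\in\mathbb R$ define \[ W_1(t,u)=\frac{1}{1-m}\mathbf 1_{(mt,t]}(u),\qquad W_{n+1}(t,u)=\mathbf 1_{(m^{n+1}t,t]}(u)\int_{\frac{m^{n+1}t-u}{m^n-m^{n+1}}\vee 0}^{\frac{t-u}{1-m^{n+1}}}W_n(t-s,u-m^{n+1}s)\,ds\quad(n\ge 1), \] put $P_n(u)=W_n(1,u)$ for $u\ge 0$, and for $t>0$ let $\mu_t$ be the Borel measure on $[0,\infty)$ \[ \mu_t(du)=e^{-t}\delta_t(du)+e^{-t}\sum_{j=1}^\infty t^jP_j(u/t)\,\frac{du}{t}. \] Write $(a;q)_n=\prod_{j=0}^{n-1}(1-aq^j)$, $(a;q)_\infty=\prod_{j=0}^\infty(1-aq^j)$ and $\Gamma_q(x)=(1-q)^{1-x}(q;q)_\infty/(q^x;q)_\infty$ for $0<q<1$. For $\gamma\in\{-1,-2,\dots\}$ the quotient $\Gamma(\gamma+1)/\Gamma_m(\gamma+1)$ is understood as its continuous extension \[ \frac{\Gamma(\gamma+1)}{\Gamma_m(\gamma+1)}=(1-m)^{\gamma}\Big\{\prod_{k=1}^{|\gamma|-1}\frac{1-m^{k+\gamma}}{k+\gamma}\Big\}\log(1/m).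 \] Then every $\mu_t$, $t>0$, is a probability measure, and, as $t\to+\infty$, the measures $\mu_t$ converge weakly to a probability measure $\mu$ on $[0,\infty)$ with \[ \int_0^\infty u^k\,\mu(du)=\frac{k!}{(m;m)_k},\qquad k=0,1,2,\dots, \] and $\mu$ is the only Borel measure on $[0,\infty)$ with these moments. Moreover, $\mu$ has finite moments of all orders $\gamma\in\mathbb R$, and for every $\gamma\in\mathbb R$, \[ \lim_{t\to+\infty}\int_0^\infty u^\gamma\,\mu_t(du)=\int_0^\infty u^\gamma\,\mu(du)=\frac{\Gamma(\gamma+1)}{\Gamma_m(\gamma+1)}(1-m)^{-\gamma}. \] -/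

import Mathlib

open MeasureTheory Filter Topology
open scoped NNReal ENNReal Nat

noncomputable section

namespace Resetting

/-- The functions `W_n(t, u)`, `n ≥ 1` (the value at `n = 0` is never used). -/
def W (m : ℝ) : ℕ → ℝ → ℝ → ℝ
  | 0 => fun _ _ => 0
  | 1 => fun t u => (Set.Ioc (m * t) t).indicator (fun _ => 1 / (1 - m)) u
  | n + 2 => fun t u =>
      (Set.Ioc (m ^ (n + 2) * t) t).indicator
        (fun u => ∫ s in
            (max ((m ^ (n + 2) * t - u) / (m ^ (n + 1) - m ^ (n + 2))) 0)..((t - u) / (1 - m ^ (n + 2))),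
          W m (n + 1) (t - s) (u - m ^ (n + 2) * s)) u

/-- The splines `P_n(u) = W_n(1, u)`, `n ≥ 1`. -/
def P (m : ℝ) (n : ℕ) (u : ℝ) : ℝ := W m n 1 u

/-- The measure `μ_t(du) = e^{-t} δ_t(du) + e^{-t} ∑_{j ≥ 1} t^j P_j(u/t) du/t` on `[0, ∞)`. -/
def muT (m : ℝ) (t : ℝ) : Measure ℝ≥0 :=
  ENNReal.ofReal (Real.exp (-t)) • Measure.dirac t.toNNReal
    + ENNReal.ofReal (Real.exp (-t)) •
      (Measure.comap ((↑) : ℝ≥0 → ℝ) volume).withDensity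
        (fun u => ∑' j : ℕ, ENNReal.ofReal (t ^ (j + 1) * P m (j + 1) ((u : ℝ) / t) / t))

/-- The moment `∫ u^γ ν(du)` of real order `γ` of a measure on `[0, ∞)`, as an element of
`[0, ∞]`; here `0 ^ γ = ∞` for `γ < 0`. -/
def moment (ν : Measure ℝ≥0) (γ : ℝ) : ℝ≥0∞ := ∫⁻ u, (u : ℝ≥0∞) ^ γ ∂ν

/-- `(a; q)_n = ∏_{j < n} (1 - a q^j)`. -/
def qPoch (a q : ℝ) (n : ℕ) : ℝ := ∏ j ∈ Finset.range n, (1 - a * q ^ j)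

/-- `(a; q)_∞ = ∏_{j ≥ 0} (1 - a q^j)`. -/
def qPochInf (a q : ℝ) : ℝ := ∏' j : ℕ, (1 - a * q ^ j)

/-- The `q`-gamma function `Γ_q(x) = (1 - q)^{1 - x} (q; q)_∞ / (q^x; q)_∞`. -/
def qGamma (q x : ℝ) : ℝ := (1 - q) ^ (1 - x) * (qPochInf q q / qPochInf (q ^ x) q)

open Classical in
/-- The quotient `Γ(γ + 1) / Γ_m(γ + 1)`, extended to the negative integers `γ = -n` by
its limit `(1 - m)^γ (∏_{k=1}^{n-1} (1 - m^{k+γ}) / (k + γ)) log (1/m)`. -/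
def gammaQuot (m γ : ℝ) : ℝ :=
  if ∃ n : ℕ, 1 ≤ n ∧ γ = -(n : ℝ) then
    (1 - m) ^ γ * (∏ k ∈ Finset.Ico 1 ⌊|γ|⌋₊, (1 - m ^ ((k : ℝ) + γ)) / ((k : ℝ) + γ))
      * Real.log (1 / m)
  else Real.Gamma (γ + 1) / qGamma m (γ + 1)

end Resetting

end

noncomputable section

namespace Resetting

/-! The measure `muT m t` is the law of a random variable. Let the gaps `ω 0, ω 1, …` be independent
standard exponential variables, and let X_t be the time in [0, t] with its part in the i-th gap
weighted by m^i. Given that n resets occur before t, the pieces (s_0, …, s_n) of [0, t] have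
constant density e^{-t} on the simplex s_0 + ⋯ + s_n = t, and X_t = ∑ m^i s_i. Splitting off the
last piece s_n is exactly the recursion of W_n, so W_n(t, ·) is the density of ∑ m^i s_i
(`lintegral_mul_W`). Splitting off the first piece s_0 is the renewal structure of the process. Both
describe the same simplex integral (`resetInt_succ_eq`), whence `muT_eq_map`.

On one probability space X_t increases to X = ∑ m^i ω_i, so weak convergence and convergence of
moments are dominated convergence. The bound for γ ≥ 1 comes from convexity, the one for γ ≤ 0 from
X_1 ≥ m^n when there are n resets before time 1.

The identity X = ω_0 + m X' in law, with X' an independent copy of X, and one integration by parts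
against e^{-s} give (1 - m^γ) M(γ) = γ M(γ - 1) for M(γ) = E X^γ. Iteration from M(0) = 1 gives the
integer moments, and γ → 0 gives M(-1) = log(1/m), hence all negative integers. For γ > -1 the
solution is singled out by the Bohr–Mollerup theorem: M is log-convex by Hölder, and dividing by the
q-product (m^{γ+1}; m)_∞ keeps log-convexity. The functional equation carries the formula to the
other γ.

Uniqueness holds because k!/(m;m)_k ≤ k!/(1-m)^k forces an exponential moment, and then the complex
moment generating function is determined by its Taylor series at 0. -/

/-! ### Integrals over the simplex of gap lengths. -/

/-- Interchange of integrals on the triangle `0 < s`, `0 < r`, `s + r < t`. -/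
theorem lintegral_triangle_swap (t : ℝ) {G : ℝ → ℝ → ℝ≥0∞}
    (hG : Measurable (Function.uncurry G)) :
    ∫⁻ s in Set.Ioo 0 t, ∫⁻ r in Set.Ioo 0 (t - s), G s r =
      ∫⁻ r in Set.Ioo 0 t, ∫⁻ s in Set.Ioo 0 (t - r), G s r := by
  have hT : MeasurableSet {p : ℝ × ℝ | 0 < p.1 ∧ 0 < p.2 ∧ p.1 + p.2 < t} := by
    apply MeasurableSet.inter (measurableSet_lt measurable_const measurable_fst)
    apply MeasurableSet.inter (measurableSet_lt measurable_const measurable_snd)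
    exact measurableSet_lt (measurable_fst.add measurable_snd) measurable_const
  set H : ℝ × ℝ → ℝ≥0∞ :=
    {p : ℝ × ℝ | 0 < p.1 ∧ 0 < p.2 ∧ p.1 + p.2 < t}.indicator (Function.uncurry G) with hH
  have hHm : Measurable H := hG.indicator hT
  have h1 : ∫⁻ s in Set.Ioo 0 t, ∫⁻ r in Set.Ioo 0 (t - s), G s r =
      ∫⁻ s, ∫⁻ r, H (s, r) := by
    rw [← lintegral_indicator measurableSet_Ioo]
    refine lintegral_congr fun s => ?_
    by_cases hs : s ∈ Set.Ioo 0 t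
    · rw [Set.indicator_of_mem hs, ← lintegral_indicator measurableSet_Ioo]
      refine lintegral_congr fun r => ?_
      simp only [hH, Set.indicator, Set.mem_Ioo, Set.mem_ofPred_eq, Function.uncurry]
      congr 1
      simp only [eq_iff_iff]
      constructor
      · intro h; exact ⟨hs.1, h.1, by linarith [h.2]⟩
      · intro h; exact ⟨h.2.1, by linarith [h.2.2]⟩
    · rw [Set.indicator_of_notMem hs]
      symm
      refine (lintegral_congr fun r => ?_).trans lintegral_zero
      refine Set.indicator_of_notMem (fun h => hs ⟨h.1, ?_⟩) _
      have := h.2.1; have := h.2.2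
      simp only at *
      linarith
  have h2 : ∫⁻ r in Set.Ioo 0 t, ∫⁻ s in Set.Ioo 0 (t - r), G s r =
      ∫⁻ r, ∫⁻ s, H (s, r) := by
    rw [← lintegral_indicator measurableSet_Ioo]
    refine lintegral_congr fun r => ?_
    by_cases hr : r ∈ Set.Ioo 0 t
    · rw [Set.indicator_of_mem hr, ← lintegral_indicator measurableSet_Ioo]
      refine lintegral_congr fun s => ?_
      simp only [hH, Set.indicator, Set.mem_Ioo, Set.mem_ofPred_eq, Function.uncurry]
      congr 1
      simp only [eq_iff_iff]
      constructor
      · intro h; exact ⟨h.1, hr.1, by linarith [h.2]⟩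
      · intro h; exact ⟨h.1, by linarith [h.2.2]⟩
    · rw [Set.indicator_of_notMem hr]
      symm
      refine (lintegral_congr fun s => ?_).trans lintegral_zero
      refine Set.indicator_of_notMem (fun h => hr ⟨h.2.1, ?_⟩) _
      have := h.1; have := h.2.2
      simp only at *
      linarith
  rw [h1, h2]
  exact lintegral_lintegral_swap hHm.aemeasurable

/-- `resetInt m n t f` is the integral of `f (∑_{i ≤ n} m^i s_i)` over the simplex of all
`s_0, …, s_n > 0` with `s_0 + ⋯ + s_n = t`, parametrized by `s_1, …, s_n`. -/
def resetInt (m : ℝ) : ℕ → ℝ → (ℝ≥0∞ → ℝ≥0∞) → ℝ≥0∞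
  | 0, t, f => f (ENNReal.ofReal t)
  | n + 1, t, f => ∫⁻ s in Set.Ioo 0 t,
      resetInt m n (t - s) (fun x => f (x + ENNReal.ofReal (m ^ (n + 1) * s)))

theorem measurable_lintegral_Ioo {α : Type} [MeasurableSpace α] {G : α → ℝ → ℝ → ℝ≥0∞}
    (hG : Measurable (fun p : (α × ℝ) × ℝ => G p.1.1 p.1.2 p.2)) :
    Measurable (fun p : α × ℝ => ∫⁻ s in Set.Ioo 0 p.2, G p.1 p.2 s) := by
  have h : (fun p : α × ℝ => ∫⁻ s in Set.Ioo 0 p.2, G p.1 p.2 s) =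
      fun p : α × ℝ => ∫⁻ s, {q : (α × ℝ) × ℝ | 0 < q.2 ∧ q.2 < q.1.2}.indicator
        (fun q => G q.1.1 q.1.2 q.2) (p, s) := by
    funext p
    rw [← lintegral_indicator measurableSet_Ioo]
    rfl
  rw [h]
  apply Measurable.lintegral_prod_right'
    (f := {q : (α × ℝ) × ℝ | 0 < q.2 ∧ q.2 < q.1.2}.indicator (fun q => G q.1.1 q.1.2 q.2))
  refine hG.indicator ?_
  exact MeasurableSet.inter (measurableSet_lt measurable_const measurable_snd)
    (measurableSet_lt measurable_snd (measurable_snd.comp measurable_fst))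

/-- The parameter space is arbitrary because the induction moves the split-off coordinate s into the
parameter, replacing `α` by `α × ℝ`. -/
theorem measurable_resetInt (m : ℝ) (n : ℕ) {α : Type} [MeasurableSpace α]
    {F : α → ℝ≥0∞ → ℝ≥0∞} (hF : Measurable (Function.uncurry F)) :
    Measurable (fun p : α × ℝ => resetInt m n p.2 (F p.1)) := by
  induction n generalizing α with
  | zero =>
    exact hF.comp (measurable_fst.prodMk (ENNReal.measurable_ofReal.comp measurable_snd))
  | succ n ih =>
    refine measurable_lintegral_Ioo
      (G := fun a t s => resetInt m n (t - s)
        (fun x => F a (x + ENNReal.ofReal (m ^ (n + 1) * s)))) ?_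
    have h := ih (α := α × ℝ)
      (F := fun q x => F q.1 (x + ENNReal.ofReal (m ^ (n + 1) * q.2))) (by
        refine hF.comp (Measurable.prodMk (measurable_fst.comp measurable_fst) ?_)
        fun_prop)
    exact h.comp (f := fun q : ((α × ℝ) × ℝ) => ((q.1.1, q.2), q.1.2 - q.2)) (by fun_prop)

theorem measurable_resetInt_comp (m : ℝ) (n : ℕ) {α : Type} [MeasurableSpace α]
    {F : α → ℝ≥0∞ → ℝ≥0∞} (hF : Measurable (Function.uncurry F)) {g : α → ℝ}
    (hg : Measurable g) : Measurable (fun a => resetInt m n (g a) (F a)) :=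
  (measurable_resetInt m n hF).comp (measurable_id.prodMk hg)

/-- The recursion of `resetInt` that separates the first coordinate `s_0`. -/
theorem resetInt_succ_eq {m : ℝ} (hm : 0 ≤ m) (n : ℕ) (t : ℝ) {f : ℝ≥0∞ → ℝ≥0∞}
    (hf : Measurable f) :
    resetInt m (n + 1) t f = ∫⁻ s in Set.Ioo 0 t,
      resetInt m n (t - s) (fun x => f (ENNReal.ofReal s + ENNReal.ofReal m * x)) := by
  induction n generalizing t f with
  | zero =>
    simp only [resetInt]
    -- With only two coordinates, the reflection s ↦ t - s exchanges them.
    rw [← lintegral_indicator measurableSet_Ioo, ← lintegral_indicator measurableSet_Ioo,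
      ← lintegral_sub_left_eq_self _ t]
    refine lintegral_congr fun s => ?_
    have hmem : t - s ∈ Set.Ioo 0 t ↔ s ∈ Set.Ioo 0 t := by
      simp only [Set.mem_Ioo]
      constructor <;> rintro ⟨h1, h2⟩ <;> constructor <;> linarith
    by_cases hs : s ∈ Set.Ioo 0 t
    · rw [Set.indicator_of_mem hs, Set.indicator_of_mem (hmem.2 hs)]
      simp only [zero_add, pow_one, sub_sub_cancel, ENNReal.ofReal_mul hm]
    · rw [Set.indicator_of_notMem hs, Set.indicator_of_notMem (fun h => hs (hmem.1 h))]
  | succ n ih =>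
    have hL : resetInt m (n + 2) t f = ∫⁻ s in Set.Ioo 0 t, ∫⁻ r in Set.Ioo 0 (t - s),
        resetInt m n (t - s - r) (fun x => f (ENNReal.ofReal r + ENNReal.ofReal m * x
          + ENNReal.ofReal (m ^ (n + 2) * s))) := by
      rw [resetInt]
      refine lintegral_congr fun s => ?_
      exact ih (t - s) (f := fun x => f (x + ENNReal.ofReal (m ^ (n + 2) * s)))
        (hf.comp (by fun_prop))
    -- Here s is the last coordinate, r the first. Integrating over s inside lets the last
    -- coordinate be absorbed again.
    rw [hL, lintegral_triangle_swap t (G := fun s r => resetInt m n (t - s - r)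
      (fun x => f (ENNReal.ofReal r + ENNReal.ofReal m * x
          + ENNReal.ofReal (m ^ (n + 2) * s))))]
    · refine lintegral_congr fun r => ?_
      rw [resetInt]
      refine lintegral_congr fun s => ?_
      rw [sub_right_comm]
      congr 1
      funext x
      rw [mul_add, ← ENNReal.ofReal_mul hm, add_assoc]
      congr 4
      ring
    · exact measurable_resetInt_comp m n (α := ℝ × ℝ)
        (F := fun p x => f (ENNReal.ofReal p.2 + ENNReal.ofReal m * x
          + ENNReal.ofReal (m ^ (n + 2) * p.1))) (hf.comp (by fun_prop)) (by fun_prop)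

theorem resetInt_const (m : ℝ) (n : ℕ) {t : ℝ} (ht : 0 ≤ t) :
    resetInt m n t (fun _ => 1) = ENNReal.ofReal (t ^ n / n !) := by
  induction n generalizing t with
  | zero => simp [resetInt]
  | succ n ih =>
    rw [resetInt]
    have h1 : ∫⁻ s in Set.Ioo 0 t, resetInt m n (t - s) (fun _ => 1) =
        ∫⁻ s in Set.Ioo 0 t, ENNReal.ofReal ((t - s) ^ n / n !) :=
      setLIntegral_congr_fun measurableSet_Ioo fun s hs => ih (by linarith [hs.2])
    rw [h1, ← ofReal_integral_eq_lintegral_ofReal]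
    · rw [← integral_Ioc_eq_integral_Ioo, ← intervalIntegral.integral_of_le ht,
        intervalIntegral.integral_div,
        intervalIntegral.integral_comp_sub_left (fun x => x ^ n) t, integral_pow]
      congr 1
      simp only [sub_self, sub_zero, Nat.factorial_succ, Nat.cast_mul, Nat.cast_add, Nat.cast_one,
        zero_pow (Nat.succ_ne_zero n)]
      rw [div_div]
    · exact ((by fun_prop : Continuous fun s : ℝ => (t - s) ^ n / (n ! : ℝ)).integrableOn_Icc
        (a := 0) (b := t)).mono_set Set.Ioo_subset_Icc_self
    · refine (ae_restrict_iff' measurableSet_Ioo).2 (Filter.Eventually.of_forall fun s hs => ?_)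
      have : 0 ≤ t - s := by linarith [hs.2]
      positivity

/-- On the simplex ∑ m^i s_i ≥ m^n t, and the simplex has volume t^n/n!. This is the source of the
negative moments. -/
theorem resetInt_le {m : ℝ} (hm0 : 0 < m) (hm1 : m < 1) (n : ℕ) {t : ℝ} (ht : 0 ≤ t)
    {f : ℝ≥0∞ → ℝ≥0∞} {C : ℝ≥0∞} (hf : ∀ x, ENNReal.ofReal (m ^ n * t) ≤ x → f x ≤ C) :
    resetInt m n t f ≤ C * ENNReal.ofReal (t ^ n / n !) := by
  induction n generalizing t f with
  | zero => simpa [resetInt] using hf _ (by simp)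
  | succ n ih =>
    rw [← resetInt_const m (n + 1) ht, resetInt, resetInt]
    have hmeas : Measurable fun s : ℝ => resetInt m n (t - s) (fun _ => 1) :=
      measurable_resetInt_comp m n (F := fun _ _ => 1) measurable_const (by fun_prop)
    rw [← lintegral_const_mul _ hmeas]
    refine setLIntegral_mono (hmeas.const_mul C) fun s hs => ?_
    have hts : 0 ≤ t - s := by linarith [hs.2]
    rw [resetInt_const m n hts]
    refine ih hts fun x hx => hf _ ?_
    have h1 : m ^ (n + 1) * t ≤ m ^ n * (t - s) + m ^ (n + 1) * s := by
      have : m ^ (n + 1) ≤ m ^ n := pow_le_pow_of_le_one hm0.le hm1.le (Nat.le_succ n)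
      nlinarith
    calc ENNReal.ofReal (m ^ (n + 1) * t)
        ≤ ENNReal.ofReal (m ^ n * (t - s) + m ^ (n + 1) * s) := ENNReal.ofReal_le_ofReal h1
      _ ≤ ENNReal.ofReal (m ^ n * (t - s)) + ENNReal.ofReal (m ^ (n + 1) * s) :=
        ENNReal.ofReal_add_le
      _ ≤ _ := by gcongr

/-! ### The functions W_n as densities of simplex integrals. -/

theorem W_one (m t u : ℝ) :
    W m 1 t u = (Set.Ioc (m * t) t).indicator (fun _ => 1 / (1 - m)) u := rfl

theorem W_add_two (m : ℝ) (n : ℕ) (t u : ℝ) :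
    W m (n + 2) t u = (Set.Ioc (m ^ (n + 2) * t) t).indicator
        (fun u => ∫ s in
            (max ((m ^ (n + 2) * t - u) / (m ^ (n + 1) - m ^ (n + 2))) 0)..
              ((t - u) / (1 - m ^ (n + 2))),
          W m (n + 1) (t - s) (u - m ^ (n + 2) * s)) u := rfl

theorem one_sub_pow_pos {m : ℝ} (hm0 : 0 < m) (hm1 : m < 1) (n : ℕ) : 0 < 1 - m ^ (n + 1) :=
  sub_pos.2 (pow_lt_one₀ hm0.le hm1 n.succ_ne_zero)

theorem W_eq_zero (m : ℝ) (n : ℕ) {t u : ℝ} (h : u ∉ Set.Ioc (m ^ (n + 1) * t) t) :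
    W m (n + 1) t u = 0 := by
  cases n with
  | zero =>
    rw [zero_add, pow_one] at h
    rw [zero_add, W_one, Set.indicator_of_notMem h]
  | succ n => rw [W_add_two, Set.indicator_of_notMem h]

theorem pos_of_mem_Ioc {q t u : ℝ} (hq : q < 1) (h : u ∈ Set.Ioc (q * t) t) : 0 < t := by
  have := h.1.trans_le h.2
  nlinarith

/-- On its support, `W_{n+2}` is an integral with lower limit `0`. -/
theorem W_succ_of_mem {m : ℝ} (hm0 : 0 < m) (hm1 : m < 1) (n : ℕ) {t u : ℝ}
    (h : u ∈ Set.Ioc (m ^ (n + 2) * t) t) :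
    W m (n + 2) t u = ∫ s in (0 : ℝ)..((t - u) / (1 - m ^ (n + 2))),
      W m (n + 1) (t - s) (u - m ^ (n + 2) * s) := by
  have hd : 0 < m ^ (n + 1) - m ^ (n + 2) := 
    sub_pos.2 (pow_lt_pow_right_of_lt_one₀ hm0 hm1 (Nat.lt_succ_self (n + 1)))
  rw [W_add_two, Set.indicator_of_mem h, max_eq_right]
  exact div_nonpos_of_nonpos_of_nonneg (by linarith [h.1]) hd.le

theorem abs_W_le {m : ℝ} (hm0 : 0 < m) (hm1 : m < 1) (n : ℕ) (t u : ℝ) :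
    |W m (n + 1) t u| ≤ |t| ^ n / (1 - m) := by
  have h1m : 0 < 1 - m := by linarith
  induction n generalizing t u with
  | zero =>
    rw [zero_add, W_one]
    by_cases h : u ∈ Set.Ioc (m * t) t
    · rw [Set.indicator_of_mem h, pow_zero, abs_of_pos (by positivity)]
    · rw [Set.indicator_of_notMem h, abs_zero]
      positivity
  | succ n ih =>
    by_cases h : u ∈ Set.Ioc (m ^ (n + 2) * t) t
    · have ht : 0 < t := pos_of_mem_Ioc (pow_lt_one₀ hm0.le hm1 (by omega)) h
      have hq : 0 < 1 - m ^ (n + 2) := one_sub_pow_pos hm0 hm1 (n + 1)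
      have hb0 : 0 ≤ (t - u) / (1 - m ^ (n + 2)) := div_nonneg (by linarith [h.2]) hq.le
      have hbt : (t - u) / (1 - m ^ (n + 2)) ≤ t := by
        rw [div_le_iff₀ hq]; linarith [h.1]
      rw [W_succ_of_mem hm0 hm1 n h]
      have := intervalIntegral.norm_integral_le_of_norm_le_const (a := 0)
        (b := (t - u) / (1 - m ^ (n + 2))) (C := t ^ n / (1 - m))
        (f := fun s => W m (n + 1) (t - s) (u - m ^ (n + 2) * s)) (fun s hs => by
          rw [Set.uIoc_of_le hb0] at hs
          refine (ih (t - s) _).trans ?_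
          have : 0 ≤ t - s := by linarith [hs.2]
          rw [abs_of_nonneg this]
          gcongr
          linarith [hs.1])
      refine this.trans ?_
      rw [sub_zero, abs_of_nonneg hb0, abs_of_pos ht, pow_succ t, div_mul_eq_mul_div]
      gcongr
    · rw [W_eq_zero m (n + 1) h, abs_zero]
      positivity

theorem W_nonneg {m : ℝ} (hm0 : 0 < m) (hm1 : m < 1) (n : ℕ) (t u : ℝ) :
    0 ≤ W m (n + 1) t u := by
  have h1m : 0 < 1 - m := by linarith
  induction n generalizing t u with
  | zero => rw [zero_add, W_one]; exact Set.indicator_nonneg (fun _ _ => by positivity) u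
  | succ n ih =>
    by_cases h : u ∈ Set.Ioc (m ^ (n + 2) * t) t
    · rw [W_succ_of_mem hm0 hm1 n h]
      have hq : 0 < 1 - m ^ (n + 2) := one_sub_pow_pos hm0 hm1 (n + 1)
      exact intervalIntegral.integral_nonneg (div_nonneg (by linarith [h.2]) hq.le)
        fun s _ => ih _ _
    · rw [W_eq_zero m (n + 1) h]

/-- Homogeneity turns the rescaled splines t^j P_j(u/t)/t of `muT` back into W_j(t, u). -/
theorem W_scale {m : ℝ} (hm0 : 0 < m) (hm1 : m < 1) (n : ℕ) {l : ℝ} (hl : 0 < l) (t u : ℝ) :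
    W m (n + 1) (l * t) (l * u) = l ^ n * W m (n + 1) t u := by
  have hmem (k : ℕ) : l * u ∈ Set.Ioc (m ^ k * (l * t)) (l * t) ↔ u ∈ Set.Ioc (m ^ k * t) t := by
    simp only [Set.mem_Ioc]
    rw [mul_left_comm, mul_lt_mul_iff_right₀ hl, mul_le_mul_iff_right₀ hl]
  induction n generalizing t u with
  | zero =>
    have := hmem 1
    rw [pow_one] at this
    simp only [W, Set.indicator, this, pow_zero, one_mul]
  | succ n ih =>
    by_cases h : u ∈ Set.Ioc (m ^ (n + 2) * t) t
    · rw [W_succ_of_mem hm0 hm1 n h, W_succ_of_mem hm0 hm1 n ((hmem _).2 h)]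
      have h1 : (l * t - l * u) / (1 - m ^ (n + 2)) = l * ((t - u) / (1 - m ^ (n + 2))) := by ring
      rw [h1]
      have h2 := intervalIntegral.integral_comp_mul_left (a := 0)
        (b := (t - u) / (1 - m ^ (n + 2)))
        (fun s => W m (n + 1) (l * t - s) (l * u - m ^ (n + 2) * s)) hl.ne'
      have hin (p q : ℝ) := ih p q (fun k => by
        simp only [Set.mem_Ioc]
        rw [mul_left_comm, mul_lt_mul_iff_right₀ hl, mul_le_mul_iff_right₀ hl])
      rw [mul_zero, eq_inv_smul_iff₀ hl.ne'] at h2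
      rw [← h2, smul_eq_mul, pow_succ' l, mul_assoc,
        ← intervalIntegral.integral_const_mul (l ^ n)]
      refine congrArg (l * ·) (intervalIntegral.integral_congr fun s _ => ?_)
      rw [← hin]
      congr 1 <;> ring
    · rw [W_eq_zero m (n + 1) h, W_eq_zero m (n + 1) (fun h' => h ((hmem _).1 h')), mul_zero]

/-- The cutoffs of the recursion are redundant: the support of the integrand already forces s ≤ (t -
u)/(1 - m^{n+2}) and u in the outer interval, so s may range over (0, t). Measurability is a
hypothesis because `measurable_W` derives it inductively from this formula. -/
theorem ofReal_W_succ_of_measurable {m : ℝ} (hm0 : 0 < m) (hm1 : m < 1) (n : ℕ)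
    (hmeas : Measurable (fun p : ℝ × ℝ => W m (n + 1) p.1 p.2)) (t u : ℝ) :
    ENNReal.ofReal (W m (n + 2) t u) = ∫⁻ s in Set.Ioo 0 t,
      ENNReal.ofReal (W m (n + 1) (t - s) (u - m ^ (n + 2) * s)) := by
  have hq : 0 < 1 - m ^ (n + 2) := one_sub_pow_pos hm0 hm1 (n + 1)
  have hd : m ^ (n + 2) < m ^ (n + 1) :=
    pow_lt_pow_right_of_lt_one₀ hm0 hm1 (Nat.lt_succ_self (n + 1))
  by_cases h : u ∈ Set.Ioc (m ^ (n + 2) * t) t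
  · set b := (t - u) / (1 - m ^ (n + 2)) with hb
    have ht : 0 < t := pos_of_mem_Ioc (pow_lt_one₀ hm0.le hm1 (by omega)) h
    have hb0 : 0 ≤ b := div_nonneg (by linarith [h.2]) hq.le
    have hbt : b < t := by rw [hb, div_lt_iff₀ hq]; linarith [h.1]
    have hms : Measurable fun s => W m (n + 1) (t - s) (u - m ^ (n + 2) * s) :=
      hmeas.comp (f := fun s : ℝ => (t - s, u - m ^ (n + 2) * s)) (by fun_prop)
    rw [W_succ_of_mem hm0 hm1 n h, intervalIntegral.integral_of_le hb0,
      ofReal_integral_eq_lintegral_ofReal]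
    · rw [← lintegral_indicator measurableSet_Ioc, ← lintegral_indicator measurableSet_Ioo]
      refine lintegral_congr fun s => ?_
      by_cases hs : s ∈ Set.Ioc 0 b
      · rw [Set.indicator_of_mem hs, Set.indicator_of_mem (show s ∈ Set.Ioo 0 t from ⟨hs.1, hs.2.trans_lt hbt⟩)]
      · rw [Set.indicator_of_notMem hs]
        by_cases hs' : s ∈ Set.Ioo 0 t
        · rw [Set.indicator_of_mem hs', W_eq_zero, ENNReal.ofReal_zero]
          intro hmem
          refine hs ⟨hs'.1, ?_⟩
          rw [hb, le_div_iff₀ hq]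
          linarith [hmem.2]
        · rw [Set.indicator_of_notMem hs']
    · refine Measure.integrableOn_of_bounded (M := t ^ n / (1 - m)) (by simp)
        hms.aestronglyMeasurable ?_
      refine (ae_restrict_iff' measurableSet_Ioc).2 (Filter.Eventually.of_forall fun s hs => ?_)
      refine (abs_W_le hm0 hm1 n (t - s) _).trans ?_
      have : 0 ≤ t - s := by linarith [hs.2]
      rw [abs_of_nonneg this]
      have : 0 ≤ 1 - m := by linarith
      gcongr
      linarith [hs.1]
    · exact Filter.Eventually.of_forall fun s => W_nonneg hm0 hm1 n _ _
  · rw [W_eq_zero m (n + 1) h, ENNReal.ofReal_zero]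
    symm
    rw [← lintegral_indicator measurableSet_Ioo]
    refine (lintegral_congr fun s => ?_).trans lintegral_zero
    by_cases hs : s ∈ Set.Ioo 0 t
    · rw [Set.indicator_of_mem hs, W_eq_zero, ENNReal.ofReal_zero]
      intro hmem
      have h1 := hmem.1
      have h2 := hmem.2
      have h3 := hs.1
      have h4 := hs.2
      exact h ⟨by nlinarith, by nlinarith⟩
    · rw [Set.indicator_of_notMem hs]

theorem measurable_W {m : ℝ} (hm0 : 0 < m) (hm1 : m < 1) (n : ℕ) :
    Measurable (fun p : ℝ × ℝ => W m (n + 1) p.1 p.2) := by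
  induction n with
  | zero =>
    have : (fun p : ℝ × ℝ => W m 1 p.1 p.2) =
        {p : ℝ × ℝ | m * p.1 < p.2 ∧ p.2 ≤ p.1}.indicator (fun _ => 1 / (1 - m)) := rfl
    rw [this]
    refine measurable_const.indicator (MeasurableSet.inter ?_ ?_)
    · exact measurableSet_lt (by fun_prop) measurable_snd
    · exact measurableSet_le measurable_snd measurable_fst
  | succ n ih =>
    have : (fun p : ℝ × ℝ => W m (n + 2) p.1 p.2) = fun p => (∫⁻ s in Set.Ioo 0 p.1,
        ENNReal.ofReal (W m (n + 1) (p.1 - s) (p.2 - m ^ (n + 2) * s))).toReal := by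
      funext p
      rw [← ofReal_W_succ_of_measurable hm0 hm1 n ih,
        ENNReal.toReal_ofReal (W_nonneg hm0 hm1 (n + 1) _ _)]
    rw [this]
    refine Measurable.ennreal_toReal ?_
    refine (measurable_lintegral_Ioo (α := ℝ) (G := fun u t s =>
      ENNReal.ofReal (W m (n + 1) (t - s) (u - m ^ (n + 2) * s))) ?_).comp measurable_swap
    refine ENNReal.measurable_ofReal.comp (ih.comp
      (f := fun q : (ℝ × ℝ) × ℝ => (q.1.2 - q.2, q.1.1 - m ^ (n + 2) * q.2)) (by fun_prop))

theorem ofReal_W_succ {m : ℝ} (hm0 : 0 < m) (hm1 : m < 1) (n : ℕ) (t u : ℝ) :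
    ENNReal.ofReal (W m (n + 2) t u) = ∫⁻ s in Set.Ioo 0 t,
      ENNReal.ofReal (W m (n + 1) (t - s) (u - m ^ (n + 2) * s)) :=
  ofReal_W_succ_of_measurable hm0 hm1 n (measurable_W hm0 hm1 n) t u

/-- Both sides obey the recursion that splits off the last coordinate; for W it becomes a
translation of u by m^{n+2} s. -/
theorem lintegral_mul_W {m : ℝ} (hm0 : 0 < m) (hm1 : m < 1) (n : ℕ) (t : ℝ)
    {f : ℝ≥0∞ → ℝ≥0∞} (hf : Measurable f) :
    ∫⁻ u, f (ENNReal.ofReal u) * ENNReal.ofReal (W m (n + 1) t u) =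
      resetInt m (n + 1) t f := by
  induction n generalizing t f with
  | zero =>
    have h1m : 0 < 1 - m := by linarith
    -- The change of variables u = s_0 + m s_1 = (t - s) + m s, with Jacobian 1 - m.
    have himg : (fun s => t - (1 - m) * s) '' Set.Ioo 0 t = Set.Ioo (m * t) t := by
      ext u
      constructor
      · rintro ⟨s, hs, rfl⟩
        have := hs.1
        have := hs.2
        constructor <;> nlinarith
      · intro hu
        refine ⟨(t - u) / (1 - m), ⟨div_pos (by linarith [hu.2]) h1m, ?_⟩, ?_⟩
        · rw [div_lt_iff₀ h1m]; linarith [hu.1]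
        · simp only
          field_simp
          ring
    have hsub := lintegral_image_eq_lintegral_abs_deriv_mul (s := Set.Ioo 0 t)
      (f := fun s => t - (1 - m) * s) (f' := fun _ => -(1 - m)) measurableSet_Ioo
      (fun x _ => by
        simpa using (((hasDerivAt_id x).const_mul (1 - m)).const_sub t).hasDerivWithinAt)
      (fun x _ y _ h => by
        simp only at h
        have : (1 - m) * (x - y) = 0 := by linarith
        rcases mul_eq_zero.1 this with h | h <;> linarith)
      (fun u => f (ENNReal.ofReal u) * ENNReal.ofReal (1 / (1 - m)))
    rw [himg] at hsub
    have hL : ∫⁻ u, f (ENNReal.ofReal u) * ENNReal.ofReal (W m 1 t u) =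
        ∫⁻ u in Set.Ioo (m * t) t, f (ENNReal.ofReal u) * ENNReal.ofReal (1 / (1 - m)) := by
      rw [restrict_Ioo_eq_restrict_Ioc, ← lintegral_indicator measurableSet_Ioc]
      refine lintegral_congr fun u => ?_
      by_cases hu : u ∈ Set.Ioc (m * t) t
      · rw [Set.indicator_of_mem hu, W_one, Set.indicator_of_mem hu]
      · rw [Set.indicator_of_notMem hu, W_one, Set.indicator_of_notMem hu, ENNReal.ofReal_zero,
          mul_zero]
    rw [hL, hsub]
    refine setLIntegral_congr_fun measurableSet_Ioo fun s hs => ?_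
    simp only [resetInt]
    have h2 := hs.2
    have h1 := hs.1
    rw [abs_neg, abs_of_pos h1m, mul_left_comm, ← ENNReal.ofReal_mul h1m.le,
      mul_one_div_cancel h1m.ne', ENNReal.ofReal_one, mul_one,
      ← ENNReal.ofReal_add (by linarith) (by positivity)]
    congr 2
    ring
  | succ n ih =>
    have hmW := measurable_W hm0 hm1 n
    have h1 : ∫⁻ u, f (ENNReal.ofReal u) * ENNReal.ofReal (W m (n + 2) t u) =
        ∫⁻ u, ∫⁻ s in Set.Ioo 0 t, f (ENNReal.ofReal u) *
          ENNReal.ofReal (W m (n + 1) (t - s) (u - m ^ (n + 2) * s)) := by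
      refine lintegral_congr fun u => ?_
      rw [ofReal_W_succ hm0 hm1, lintegral_const_mul]
      exact ENNReal.measurable_ofReal.comp
        (hmW.comp (f := fun s : ℝ => (t - s, u - m ^ (n + 2) * s)) (by fun_prop))
    rw [h1, lintegral_lintegral_swap, resetInt]
    · refine setLIntegral_congr_fun measurableSet_Ioo fun s hs => ?_
      rw [← ih (t - s) (f := fun x => f (x + ENNReal.ofReal (m ^ (n + 2) * s)))
        (hf.comp (by fun_prop)), ← lintegral_add_right_eq_self _ (m ^ (n + 2) * s)]
      refine lintegral_congr fun v => ?_
      simp only [add_sub_cancel_right]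
      -- `ENNReal.ofReal` is additive only on nonnegative numbers; the support of W guarantees v ≥
      -- 0.
      by_cases hv : v ∈ Set.Ioc (m ^ (n + 1) * (t - s)) (t - s)
      · have hts : 0 < t - s := pos_of_mem_Ioc (pow_lt_one₀ hm0.le hm1 (by omega)) hv
        have hv0 : 0 ≤ v := (mul_pos (pow_pos hm0 _) hts).le.trans hv.1.le
        rw [ENNReal.ofReal_add hv0 (mul_nonneg (pow_pos hm0 _).le hs.1.le)]
      · rw [W_eq_zero m n hv, ENNReal.ofReal_zero, mul_zero, mul_zero]
    · refine Measurable.aemeasurable ?_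
      refine Measurable.mul (hf.comp (by fun_prop)) (ENNReal.measurable_ofReal.comp
        (hmW.comp (f := fun p : ℝ × ℝ => (t - p.2, p.1 - m ^ (n + 2) * p.2)) (by fun_prop)))

/-! ### Independent exponential gaps. -/

open ProbabilityTheory

instance : IsProbabilityMeasure (expMeasure 1) := isProbabilityMeasure_expMeasure one_pos

theorem lintegral_expMeasure_one {f : ℝ → ℝ≥0∞} (hf : Measurable f) :
    ∫⁻ s, f s ∂(expMeasure 1) = ∫⁻ s in Set.Ioi 0, ENNReal.ofReal (Real.exp (-s)) * f s := by
  have h0 : expMeasure 1 = volume.withDensity (exponentialPDF 1) := rfl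
  have hm : Measurable (exponentialPDF 1) :=
    ENNReal.measurable_ofReal.comp (measurable_exponentialPDFReal 1)
  rw [h0, lintegral_withDensity_eq_lintegral_mul _ hm hf, restrict_Ioi_eq_restrict_Ici,
    ← lintegral_indicator measurableSet_Ici]
  refine lintegral_congr fun s => ?_
  by_cases hs : s ∈ Set.Ici 0
  · rw [Set.indicator_of_mem hs, Pi.mul_apply, exponentialPDF_of_nonneg hs, one_mul, one_mul]
  · rw [Set.indicator_of_notMem hs, Pi.mul_apply, exponentialPDF_of_neg (not_le.1 hs), zero_mul]

/-- The law of a sequence of independent standard exponential waiting times. -/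
def gapLaw : Measure (ℕ → ℝ) := Measure.infinitePi (fun _ => expMeasure 1)

instance : IsProbabilityMeasure gapLaw := by unfold gapLaw; infer_instance

/-- The sequence `s, ω 0, ω 1, …`. -/
def seqCons (s : ℝ) (ω : ℕ → ℝ) : ℕ → ℝ
  | 0 => s
  | i + 1 => ω i

theorem measurable_seqCons : Measurable (fun p : ℝ × (ℕ → ℝ) => seqCons p.1 p.2) := by
  refine measurable_pi_iff.2 fun i => ?_
  cases i with
  | zero => exact measurable_fst
  | succ i => exact (measurable_pi_apply i).comp measurable_snd

/-- Prepending an independent gap preserves a product law with identical factors; it suffices to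
compare finite boxes. -/
theorem map_seqCons :
    ((expMeasure 1).prod gapLaw).map (fun p => seqCons p.1 p.2) = gapLaw := by
  classical
  refine Measure.eq_infinitePi _ fun s t ht => ?_
  -- Enlarging to an initial segment ensures that coordinate 0 is present, so the box splits into
  -- its first side and a shifted box.
  obtain ⟨N, hN⟩ : ∃ N, s ⊆ Finset.range (N + 1) :=
    ⟨s.sup id, fun i hi => Finset.mem_range.2 (Nat.lt_succ_of_le (Finset.le_sup (f := id) hi))⟩
  set t' : ℕ → Set ℝ := fun i => if i ∈ s then t i else Set.univ with ht'
  have ht'm (i : ℕ) : MeasurableSet (t' i) := by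
    simp only [ht']; split_ifs
    · exact ht i
    · exact MeasurableSet.univ
  have hbox : Set.pi (s : Set ℕ) t = Set.pi (Finset.range (N + 1) : Set ℕ) t' := by
    ext x
    simp only [Set.mem_pi, Finset.mem_coe, ht']
    constructor
    · intro h i _
      split_ifs with hi
      · exact h i hi
      · trivial
    · intro h i hi
      simpa [hi] using h i (hN hi)
  have hprod : ∏ i ∈ s, expMeasure 1 (t i) = ∏ i ∈ Finset.range (N + 1), expMeasure 1 (t' i) := by
    rw [← Finset.prod_subset hN (f := fun i => expMeasure 1 (t' i))]
    · exact Finset.prod_congr rfl fun i hi => by simp [ht', hi]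
    · intro i _ hi
      simp [ht', hi]
  have hpre : (fun p : ℝ × (ℕ → ℝ) => seqCons p.1 p.2) ⁻¹'
      (Set.pi (Finset.range (N + 1) : Set ℕ) t') =
      t' 0 ×ˢ Set.pi (Finset.range N : Set ℕ) (fun i => t' (i + 1)) := by
    ext ⟨a, ω⟩
    simp only [Set.mem_preimage, Set.mem_pi, Finset.mem_coe, Finset.mem_range, Set.mem_prod]
    constructor
    · intro h
      exact ⟨h 0 (by omega), fun i hi => h (i + 1) (by omega)⟩
    · rintro ⟨h0, h1⟩ i hi
      cases i with
      | zero => exact h0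
      | succ i => exact h1 i (by omega)
  rw [hbox, hprod, Measure.map_apply measurable_seqCons
    (MeasurableSet.pi (Finset.countable_toSet _) fun i _ => ht'm i), hpre, Measure.prod_prod,
    gapLaw, Measure.infinitePi_pi _ (fun i _ => ht'm (i + 1)), Finset.prod_range_succ', mul_comm]

/-- Conditioning on the first gap: the renewal identity behind both the law of the process and the
stationarity of its limit. -/
theorem lintegral_gapLaw {F : (ℕ → ℝ) → ℝ≥0∞} (hF : Measurable F) :
    ∫⁻ ω, F ω ∂gapLaw = ∫⁻ s in Set.Ioi 0,
      ENNReal.ofReal (Real.exp (-s)) * ∫⁻ ω, F (seqCons s ω) ∂gapLaw := by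
  have hFc : Measurable fun p : ℝ × (ℕ → ℝ) => F (seqCons p.1 p.2) := hF.comp measurable_seqCons
  rw [← lintegral_expMeasure_one hFc.lintegral_prod_right', ← lintegral_prod _ hFc.aemeasurable,
    ← lintegral_map hF measurable_seqCons, map_seqCons]

theorem ae_gapLaw_pos : ∀ᵐ ω ∂gapLaw, ∀ i, 0 < ω i := by
  rw [ae_all_iff]
  intro i
  have h1 : ∀ᵐ s ∂(expMeasure 1), 0 < s := by
    have hset : {a : ℝ | ¬ 0 < a} = Set.Iic 0 := by ext; simp
    rw [ae_iff, hset, ← lintegral_indicator_one measurableSet_Iic,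
      lintegral_expMeasure_one (measurable_one.indicator measurableSet_Iic),
      ← lintegral_indicator measurableSet_Ioi]
    refine (lintegral_congr fun s => ?_).trans lintegral_zero
    by_cases hs : s ∈ Set.Ioi 0
    · rw [Set.indicator_of_mem hs, Set.indicator_of_notMem, mul_zero]
      simpa using hs
    · rw [Set.indicator_of_notMem hs]
  exact (measurePreserving_eval_infinitePi (fun _ : ℕ => expMeasure 1)
    i).quasiMeasurePreserving.ae h1

/-! ### The reset process and its law at time t. -/

/-- The time of the `n`-th reset. -/
def resetTime (n : ℕ) (ω : ℕ → ℝ) : ℝ := ∑ i ∈ Finset.range n, ω i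

/-- The process at time `t`: time spent after the `i`-th reset and before the next one
is counted with the weight `m ^ i`. -/
def resetProc (m t : ℝ) (ω : ℕ → ℝ) : ℝ≥0∞ :=
  ∑' i, ENNReal.ofReal (m ^ i * (min (resetTime (i + 1) ω) t - min (resetTime i ω) t))

@[fun_prop]
theorem measurable_resetTime (n : ℕ) : Measurable (resetTime n) :=
  Finset.measurable_fun_sum _ fun i _ => measurable_pi_apply i

@[fun_prop]
theorem measurable_resetProc (m t : ℝ) : Measurable (resetProc m t) :=
  Measurable.tsum fun i => by fun_prop

theorem resetTime_seqCons (n : ℕ) (s : ℝ) (ω : ℕ → ℝ) :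
    resetTime (n + 1) (seqCons s ω) = s + resetTime n ω := by
  rw [resetTime, Finset.sum_range_succ', add_comm]; rfl

theorem resetTime_zero (ω : ℕ → ℝ) : resetTime 0 ω = 0 := by simp [resetTime]

theorem resetTime_mono {ω : ℕ → ℝ} (h : ∀ i, 0 < ω i) : Monotone (fun n => resetTime n ω) :=
  monotone_nat_of_le_succ fun n => by
    simp only [resetTime, Finset.sum_range_succ]; linarith [h n]

theorem resetTime_nonneg {ω : ℕ → ℝ} (h : ∀ i, 0 < ω i) (n : ℕ) : 0 ≤ resetTime n ω :=
  Finset.sum_nonneg fun i _ => (h i).le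

/-- After the first reset the process starts afresh with remaining time t - s and all weights
multiplied by m. -/
theorem resetProc_seqCons_of_le {m : ℝ} (hm : 0 ≤ m) {s t : ℝ} (hs : 0 ≤ s) (hst : s ≤ t)
    (ω : ℕ → ℝ) :
    resetProc m t (seqCons s ω) =
      ENNReal.ofReal s + ENNReal.ofReal m * resetProc m (t - s) ω := by
  rw [resetProc, tsum_eq_zero_add' ENNReal.summable, resetProc, ← ENNReal.tsum_mul_left]
  congr 1
  · rw [resetTime_seqCons, resetTime_zero, resetTime_zero, add_zero, min_eq_left hst,
      min_eq_left (hs.trans hst), pow_zero, one_mul, sub_zero]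
  · refine tsum_congr fun i => ?_
    rw [resetTime_seqCons, resetTime_seqCons, ← ENNReal.ofReal_mul hm, pow_succ', mul_assoc]
    congr 3
    have h (x : ℝ) : min (s + x) t = s + min x (t - s) := by
      rw [← min_add_add_left]; congr 1; ring
    rw [h, h]; ring

theorem resetProc_seqCons_of_gt {m s t : ℝ} (ht : 0 ≤ t) (hst : t < s)
    {ω : ℕ → ℝ} (hω : ∀ i, 0 < ω i) : resetProc m t (seqCons s ω) = ENNReal.ofReal t := by
  rw [resetProc, tsum_eq_single 0]
  · rw [resetTime_seqCons, resetTime_zero, resetTime_zero, add_zero, min_eq_right hst.le,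
      min_eq_left ht, pow_zero, one_mul, sub_zero]
  · intro i hi
    obtain ⟨j, rfl⟩ := Nat.exists_eq_succ_of_ne_zero hi
    have h (k : ℕ) : min (s + resetTime k ω) t = t :=
      min_eq_right (by linarith [resetTime_nonneg hω k])
    rw [Nat.succ_eq_add_one, resetTime_seqCons, resetTime_seqCons, h, h, sub_self, mul_zero,
      ENNReal.ofReal_zero]

/-- The event that exactly `n` resets have taken place up to time `t`. -/
def resetCount (n : ℕ) (t : ℝ) : Set (ℕ → ℝ) := {ω | resetTime n ω ≤ t ∧ t < resetTime (n + 1) ω}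

theorem measurableSet_resetCount (n : ℕ) (t : ℝ) : MeasurableSet (resetCount n t) :=
  (measurableSet_le (measurable_resetTime n) measurable_const).inter
    (measurableSet_lt measurable_const (measurable_resetTime (n + 1)))

/-- Condition on the first gap s: the exponential factors combine as e^{-s} e^{-(t-s)} = e^{-t}, and
what remains is the recursion `resetInt_succ_eq`. For n = 0 the factor e^{-t} is the tail of the
first gap. -/
theorem lintegral_resetCount {m : ℝ} (hm : 0 ≤ m) (n : ℕ) {t : ℝ} (ht : 0 ≤ t)
    {f : ℝ≥0∞ → ℝ≥0∞} (hf : Measurable f) :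
    ∫⁻ ω in resetCount n t, f (resetProc m t ω) ∂gapLaw =
      ENNReal.ofReal (Real.exp (-t)) * resetInt m n t f := by
  induction n generalizing t f with
  | zero =>
    rw [← lintegral_indicator (measurableSet_resetCount 0 t), lintegral_gapLaw
      (F := (resetCount 0 t).indicator (fun ω => f (resetProc m t ω)))
      ((hf.comp (measurable_resetProc m t)).indicator (measurableSet_resetCount 0 t))]
    have h1 : ∀ s ∈ Set.Ioi (0 : ℝ), ENNReal.ofReal (Real.exp (-s)) *
        ∫⁻ ω, (resetCount 0 t).indicator (fun ω => f (resetProc m t ω)) (seqCons s ω) ∂gapLaw =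
        (Set.Ioi t).indicator
          (fun s => ENNReal.ofReal (Real.exp (-s)) * f (ENNReal.ofReal t)) s := by
      intro s hs
      by_cases hst : s ∈ Set.Ioi t
      · rw [Set.indicator_of_mem hst]
        congr 1
        have : ∀ᵐ ω ∂gapLaw, (resetCount 0 t).indicator (fun ω => f (resetProc m t ω))
            (seqCons s ω) = f (ENNReal.ofReal t) := by
          filter_upwards [ae_gapLaw_pos] with ω hω
          rw [Set.indicator_of_mem, resetProc_seqCons_of_gt ht hst hω]
          refine ⟨by rw [resetTime_zero]; exact ht, ?_⟩
          rw [resetTime_seqCons, resetTime_zero, add_zero]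
          exact hst
        rw [lintegral_congr_ae this, lintegral_const, measure_univ, mul_one]
      · rw [Set.indicator_of_notMem hst]
        have (ω : ℕ → ℝ) : (resetCount 0 t).indicator (fun ω => f (resetProc m t ω))
            (seqCons s ω) = 0 := by
          refine Set.indicator_of_notMem (fun h => hst ?_) _
          have := h.2
          rwa [resetTime_seqCons, resetTime_zero, add_zero] at this
        simp only [this, lintegral_zero, mul_zero]
    rw [setLIntegral_congr_fun measurableSet_Ioi h1, setLIntegral_indicator measurableSet_Ioi,
      Set.inter_eq_left.2 (Set.Ioi_subset_Ioi ht), lintegral_mul_const _ (by fun_prop), resetInt,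
      ← ofReal_integral_eq_lintegral_ofReal (integrableOn_exp_neg_Ioi t)
        (Filter.Eventually.of_forall fun s => (Real.exp_pos _).le), integral_exp_neg_Ioi]
  | succ n ih =>
    rw [← lintegral_indicator (measurableSet_resetCount (n + 1) t), lintegral_gapLaw
      (F := (resetCount (n + 1) t).indicator (fun ω => f (resetProc m t ω)))
      ((hf.comp (measurable_resetProc m t)).indicator (measurableSet_resetCount (n + 1) t))]
    have h1 : ∀ s ∈ Set.Ioi (0 : ℝ), ENNReal.ofReal (Real.exp (-s)) * ∫⁻ ω,
        (resetCount (n + 1) t).indicator (fun ω => f (resetProc m t ω)) (seqCons s ω) ∂gapLaw =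
        (Set.Iic t).indicator (fun s => ENNReal.ofReal (Real.exp (-t)) *
          resetInt m n (t - s) (fun x => f (ENNReal.ofReal s + ENNReal.ofReal m * x))) s := by
      intro s hs
      have hs0 : 0 ≤ s := le_of_lt hs
      by_cases hst : s ∈ Set.Iic t
      · have hst' : s ≤ t := hst
        rw [Set.indicator_of_mem hst]
        have h2 (ω : ℕ → ℝ) : (resetCount (n + 1) t).indicator (fun ω => f (resetProc m t ω))
            (seqCons s ω) = (resetCount n (t - s)).indicator
              (fun ω => f (ENNReal.ofReal s + ENNReal.ofReal m * resetProc m (t - s) ω)) ω := by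
          have hmem : seqCons s ω ∈ resetCount (n + 1) t ↔ ω ∈ resetCount n (t - s) := by
            simp only [resetCount, Set.mem_ofPred_eq, resetTime_seqCons]
            rw [le_sub_iff_add_le', sub_lt_iff_lt_add']
          by_cases h : ω ∈ resetCount n (t - s)
          · rw [Set.indicator_of_mem h, Set.indicator_of_mem (hmem.2 h),
              resetProc_seqCons_of_le hm hs0 hst]
          · rw [Set.indicator_of_notMem h, Set.indicator_of_notMem (fun h' => h (hmem.1 h'))]
        rw [lintegral_congr h2, lintegral_indicator (measurableSet_resetCount n (t - s)),
          ih (sub_nonneg.2 hst') (f := fun x => f (ENNReal.ofReal s + ENNReal.ofReal m * x))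
            (hf.comp (by fun_prop)), ← mul_assoc, ← ENNReal.ofReal_mul (Real.exp_pos _).le,
          ← Real.exp_add]
        congr 4
        ring
      · rw [Set.indicator_of_notMem hst]
        have : ∀ᵐ ω ∂gapLaw, (resetCount (n + 1) t).indicator (fun ω => f (resetProc m t ω))
            (seqCons s ω) = 0 := by
          filter_upwards [ae_gapLaw_pos] with ω hω
          refine Set.indicator_of_notMem (fun h => hst ?_) _
          have := h.1
          rw [resetTime_seqCons] at this
          exact Set.mem_Iic.2 (by linarith [resetTime_nonneg hω n])
        rw [lintegral_congr_ae this, lintegral_zero, mul_zero]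
    rw [setLIntegral_congr_fun measurableSet_Ioi h1, setLIntegral_indicator measurableSet_Iic,
      Set.inter_comm, Set.Ioi_inter_Iic, lintegral_const_mul, resetInt_succ_eq hm n t hf,
      restrict_Ioo_eq_restrict_Ioc]
    exact measurable_resetInt_comp m n
      (F := fun s x => f (ENNReal.ofReal s + ENNReal.ofReal m * x)) (hf.comp (by fun_prop))
      (by fun_prop)

/-- The events are disjoint, so the sum is at most 1; its integral is the total Poisson mass ∑
e^{-t} t^n/n! = 1. Hence it is 1 almost surely, without a separate proof that the reset times
diverge. -/
theorem tsum_indicator_resetCount {t : ℝ} (ht : 0 ≤ t) :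
    ∀ᵐ ω ∂gapLaw, ∑' n, (resetCount n t).indicator (fun _ => (1 : ℝ≥0∞)) ω = 1 := by
  have hmeas (n : ℕ) : Measurable ((resetCount n t).indicator (fun _ => (1 : ℝ≥0∞))) :=
    measurable_const.indicator (measurableSet_resetCount n t)
  have hint : ∫⁻ ω, ∑' n, (resetCount n t).indicator (fun _ => (1 : ℝ≥0∞)) ω ∂gapLaw = 1 := by
    rw [lintegral_tsum fun n => (hmeas n).aemeasurable]
    have h1 (n : ℕ) : ∫⁻ ω, (resetCount n t).indicator (fun _ => (1 : ℝ≥0∞)) ω ∂gapLaw =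
        ENNReal.ofReal (Real.exp (-t)) * ENNReal.ofReal (t ^ n / n !) := by
      -- The weight is irrelevant for a constant integrand, so m = 0 serves.
      rw [lintegral_indicator (measurableSet_resetCount n t), ← resetInt_const 0 n ht]
      exact lintegral_resetCount le_rfl n ht (f := fun _ => 1) measurable_const
    rw [tsum_congr h1, ENNReal.tsum_mul_left, ← ENNReal.ofReal_tsum_of_nonneg
      (fun n => by positivity) (Real.summable_pow_div_factorial t),
      ← ENNReal.ofReal_mul (Real.exp_pos _).le]
    have : ∑' n : ℕ, t ^ n / n ! = Real.exp t := by
      rw [Real.exp_eq_exp_ℝ, NormedSpace.exp_eq_tsum_div]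
    rw [this, ← Real.exp_add, neg_add_cancel, Real.exp_zero, ENNReal.ofReal_one]
  refine ae_eq_of_ae_le_of_lintegral_le ?_ (by rw [hint]; simp) (by fun_prop)
    (by rw [hint]; simp)
  filter_upwards [ae_gapLaw_pos] with ω hω
  by_cases h : ∃ n, ω ∈ resetCount n t
  · obtain ⟨n, hn⟩ := h
    rw [tsum_eq_single n, Set.indicator_of_mem hn]
    intro k hk
    refine Set.indicator_of_notMem (fun hk' => ?_) _
    rcases lt_or_gt_of_ne hk with hlt | hlt
    · have := resetTime_mono hω (show k + 1 ≤ n from hlt)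
      exact absurd hk'.2 (not_lt.2 (le_trans this hn.1))
    · have := resetTime_mono hω (show n + 1 ≤ k from hlt)
      exact absurd hn.2 (not_lt.2 (le_trans this hk'.1))
  · push Not at h
    simp [Set.indicator_of_notMem (h _)]

theorem lintegral_resetProc {m : ℝ} (hm : 0 ≤ m) {t : ℝ} (ht : 0 ≤ t)
    {f : ℝ≥0∞ → ℝ≥0∞} (hf : Measurable f) :
    ∫⁻ ω, f (resetProc m t ω) ∂gapLaw =
      ENNReal.ofReal (Real.exp (-t)) * ∑' n, resetInt m n t f := by
  have h1 : ∀ᵐ ω ∂gapLaw, f (resetProc m t ω) =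
      ∑' n, (resetCount n t).indicator (fun ω => f (resetProc m t ω)) ω := by
    filter_upwards [tsum_indicator_resetCount ht] with ω hω
    have h2 (n : ℕ) : (resetCount n t).indicator (fun ω => f (resetProc m t ω)) ω =
        (resetCount n t).indicator (fun _ => (1 : ℝ≥0∞)) ω * f (resetProc m t ω) := by
      simp only [Set.indicator]; split_ifs <;> simp
    rw [tsum_congr h2, ENNReal.tsum_mul_right, hω, one_mul]
  rw [lintegral_congr_ae h1, lintegral_tsum, ← ENNReal.tsum_mul_left]
  · refine tsum_congr fun n => ?_
    rw [lintegral_indicator (measurableSet_resetCount n t), lintegral_resetCount hm n ht hf]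
  · exact fun n => ((hf.comp (measurable_resetProc m t)).indicator
      (measurableSet_resetCount n t)).aemeasurable

/-- The atom at t is the event of no reset, and the j-th density is the event of exactly j resets.
-/
theorem muT_eq_map {m : ℝ} (hm0 : 0 < m) (hm1 : m < 1) {t : ℝ} (ht : 0 < t) :
    muT m t = gapLaw.map (fun ω => (resetProc m t ω).toNNReal) := by
  refine Measure.ext_of_lintegral _ fun g hg => ?_
  have hWP (n : ℕ) (u : ℝ) : t ^ (n + 1) * P m (n + 1) (u / t) / t = W m (n + 1) t u := by
    have := W_scale hm0 hm1 n ht 1 (u / t)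
    rw [mul_one, mul_div_cancel₀ _ ht.ne'] at this
    rw [this, P, pow_succ]
    field_simp
  have hden (n : ℕ) : Measurable fun u : ℝ≥0 => ENNReal.ofReal (W m (n + 1) t (u : ℝ)) :=
    ENNReal.measurable_ofReal.comp ((measurable_W hm0 hm1 n).comp
      (f := fun u : ℝ≥0 => (t, (u : ℝ))) (by fun_prop))
  have hint (n : ℕ) : ∫⁻ u : ℝ≥0, ENNReal.ofReal (W m (n + 1) t (u : ℝ)) * g u
      ∂(Measure.comap ((↑) : ℝ≥0 → ℝ) volume) =
      resetInt m (n + 1) t (fun x => g x.toNNReal) := by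
    rw [← lintegral_mul_W hm0 hm1 n t (f := fun x => g x.toNNReal) (hg.comp ENNReal.measurable_toNNReal)]
    have h1 := lintegral_subtype_comap (μ := volume) (s := Set.Ici (0 : ℝ)) measurableSet_Ici
      (fun u : ℝ => g (ENNReal.ofReal u).toNNReal * ENNReal.ofReal (W m (n + 1) t u))
    have h2 : ∫⁻ u in Set.Ici (0 : ℝ),
        g (ENNReal.ofReal u).toNNReal * ENNReal.ofReal (W m (n + 1) t u) =
        ∫⁻ u : ℝ, g (ENNReal.ofReal u).toNNReal * ENNReal.ofReal (W m (n + 1) t u) := by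
      rw [← lintegral_indicator measurableSet_Ici]
      refine lintegral_congr fun u => ?_
      by_cases hu : u ∈ Set.Ici 0
      · rw [Set.indicator_of_mem hu]
      · rw [Set.indicator_of_notMem hu, W_eq_zero, ENNReal.ofReal_zero, mul_zero]
        intro h
        have := mul_pos (pow_pos hm0 (n + 1)) ht
        exact hu (this.trans h.1).le
    refine Eq.trans ?_ (h1.trans h2)
    refine lintegral_congr fun u => ?_
    rw [mul_comm]
    congr 2
    exact (ENNReal.toNNReal_coe u).symm.trans (by rw [← ENNReal.ofReal_coe_nnreal]; rfl)
  rw [lintegral_map hg (by fun_prop), lintegral_resetProc hm0.le ht.le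
    (f := fun x => g x.toNNReal) (hg.comp ENNReal.measurable_toNNReal), muT,
    lintegral_add_measure, lintegral_smul_measure, lintegral_smul_measure,
    lintegral_dirac' _ hg, tsum_eq_zero_add' ENNReal.summable]
  simp only [hWP, smul_eq_mul]
  rw [lintegral_withDensity_eq_lintegral_mul _ (Measurable.tsum hden) hg]
  simp only [Pi.mul_apply, ← ENNReal.tsum_mul_right]
  rw [lintegral_tsum (f := fun n (u : ℝ≥0) => ENNReal.ofReal (W m (n + 1) t u) * g u)
    fun n => ((hden n).mul hg).aemeasurable, tsum_congr hint, mul_add]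
  rfl

/-! ### The limit variable: monotone convergence and finiteness of all moments. -/

theorem ennreal_rpow_le_rpow_of_nonpos {γ : ℝ} (hγ : γ ≤ 0) {x y : ℝ≥0∞} (h : x ≤ y) :
    y ^ γ ≤ x ^ γ := by
  rw [← neg_neg γ, ENNReal.rpow_neg _ (-γ), ENNReal.rpow_neg _ (-γ), ENNReal.inv_le_inv]
  exact ENNReal.rpow_le_rpow h (neg_nonneg.2 hγ)

/-- The limit of `resetProc m t` as `t → ∞`. -/
def resetLimit (m : ℝ) (ω : ℕ → ℝ) : ℝ≥0∞ := ∑' i, ENNReal.ofReal (m ^ i * ω i)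

@[fun_prop]
theorem measurable_resetLimit (m : ℝ) : Measurable (resetLimit m) :=
  Measurable.tsum fun i => by fun_prop

theorem resetLimit_seqCons {m : ℝ} (hm : 0 ≤ m) (s : ℝ) (ω : ℕ → ℝ) :
    resetLimit m (seqCons s ω) = ENNReal.ofReal s + ENNReal.ofReal m * resetLimit m ω := by
  rw [resetLimit, tsum_eq_zero_add' ENNReal.summable, resetLimit, ← ENNReal.tsum_mul_left]
  congr 1
  · simp [seqCons]
  · refine tsum_congr fun i => ?_
    rw [← ENNReal.ofReal_mul hm, pow_succ', mul_assoc]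
    rfl

theorem resetProc_mono {m : ℝ} (hm : 0 ≤ m) {ω : ℕ → ℝ} (hω : ∀ i, 0 < ω i) :
    Monotone fun t => resetProc m t ω := by
  intro t₁ t₂ h
  refine ENNReal.tsum_le_tsum fun i => ENNReal.ofReal_le_ofReal ?_
  refine mul_le_mul_of_nonneg_left ?_ (pow_nonneg hm i)
  have hS : resetTime i ω ≤ resetTime (i + 1) ω := resetTime_mono hω (Nat.le_succ i)
  rcases le_total (resetTime i ω) t₁ with h1 | h1 <;>
    rcases le_total (resetTime (i + 1) ω) t₁ with h2 | h2 <;>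
    rcases le_total (resetTime i ω) t₂ with h3 | h3 <;>
    rcases le_total (resetTime (i + 1) ω) t₂ with h4 | h4 <;>
    simp only [min_eq_left, min_eq_right, h1, h2, h3, h4] <;> linarith

theorem resetProc_le_resetLimit {m : ℝ} (hm : 0 ≤ m) {ω : ℕ → ℝ} (hω : ∀ i, 0 < ω i) (t : ℝ) :
    resetProc m t ω ≤ resetLimit m ω := by
  refine ENNReal.tsum_le_tsum fun i => ENNReal.ofReal_le_ofReal ?_
  refine mul_le_mul_of_nonneg_left ?_ (pow_nonneg hm i)
  have hS : resetTime (i + 1) ω = resetTime i ω + ω i := Finset.sum_range_succ _ _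
  have := hω i
  rcases le_total (resetTime i ω) t with h1 | h1 <;>
    rcases le_total (resetTime (i + 1) ω) t with h2 | h2 <;>
    simp only [min_eq_left, min_eq_right, h1, h2] <;> linarith

/-- Once t passes the n-th reset, the first n terms have reached their final values. -/
theorem tendsto_resetProc {m : ℝ} (hm : 0 ≤ m) {ω : ℕ → ℝ} (hω : ∀ i, 0 < ω i) :
    Tendsto (fun t => resetProc m t ω) atTop (𝓝 (resetLimit m ω)) := by
  refine tendsto_order.2 ⟨fun a ha => ?_, fun a ha => ?_⟩
  · have h1 := (ENNReal.tendsto_nat_tsum fun i => ENNReal.ofReal (m ^ i * ω i))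
    obtain ⟨n, hn⟩ := ((tendsto_order.1 h1).1 a ha).exists
    filter_upwards [eventually_ge_atTop (resetTime n ω)] with t ht
    refine hn.trans_le (le_trans (Finset.sum_le_sum fun i hi => ?_)
      (ENNReal.sum_le_tsum (Finset.range n)))
    have hi' : i + 1 ≤ n := Finset.mem_range.1 hi
    have h2 : resetTime (i + 1) ω ≤ t := (resetTime_mono hω hi').trans ht
    have h3 : resetTime i ω ≤ t := (resetTime_mono hω (Nat.le_succ i)).trans h2
    rw [min_eq_left h2, min_eq_left h3, resetTime, Finset.sum_range_succ, resetTime,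
      add_sub_cancel_left]
  · exact Filter.Eventually.of_forall fun t => (resetProc_le_resetLimit hm hω t).trans_lt ha

theorem lintegral_resetLimit {m : ℝ} (hm : 0 ≤ m) {f : ℝ≥0∞ → ℝ≥0∞} (hf : Measurable f) :
    ∫⁻ ω, f (resetLimit m ω) ∂gapLaw = ∫⁻ s in Set.Ioi 0, ENNReal.ofReal (Real.exp (-s)) *
      ∫⁻ ω, f (ENNReal.ofReal s + ENNReal.ofReal m * resetLimit m ω) ∂gapLaw := by
  rw [lintegral_gapLaw (F := fun ω => f (resetLimit m ω)) (hf.comp (measurable_resetLimit m))]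
  simp only [resetLimit_seqCons hm]

/-- Writing s + mY = (1-m)·(s/(1-m)) + m·Y, convexity of x^γ gives I_{N+1} ≤ (1-m)B + m I_N, which
preserves I_N ≤ B. Partial sums are used because the same inequality for the full series says
nothing if its moment is infinite. -/
theorem lintegral_rpow_partial_le {m : ℝ} (hm0 : 0 < m) (hm1 : m < 1) {γ : ℝ} (hγ : 1 ≤ γ)
    (N : ℕ) :
    ∫⁻ ω, (∑ i ∈ Finset.range N, ENNReal.ofReal (m ^ i * ω i)) ^ γ ∂gapLaw ≤
      ∫⁻ s in Set.Ioi 0, ENNReal.ofReal (Real.exp (-s)) * ENNReal.ofReal (s / (1 - m)) ^ γ := by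
  have h1m : 0 < 1 - m := by linarith
  set B := ∫⁻ s in Set.Ioi 0,
    ENNReal.ofReal (Real.exp (-s)) * ENNReal.ofReal (s / (1 - m)) ^ γ with hB
  have hw : ENNReal.ofReal (1 - m) + ENNReal.ofReal m = 1 := by
    rw [← ENNReal.ofReal_add h1m.le hm0.le]; simp
  have hone : ∫⁻ s in Set.Ioi 0, ENNReal.ofReal (Real.exp (-s)) = 1 := by
    rw [← ofReal_integral_eq_lintegral_ofReal (integrableOn_exp_neg_Ioi 0)
      (Filter.Eventually.of_forall fun s => (Real.exp_pos _).le), integral_exp_neg_Ioi_zero,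
      ENNReal.ofReal_one]
  induction N with
  | zero => simp [ENNReal.zero_rpow_of_pos (zero_lt_one.trans_le hγ)]
  | succ N ih =>
    set I := ∫⁻ ω, (∑ i ∈ Finset.range N, ENNReal.ofReal (m ^ i * ω i)) ^ γ ∂gapLaw
    have hmeas (N : ℕ) : Measurable fun ω : ℕ → ℝ =>
        (∑ i ∈ Finset.range N, ENNReal.ofReal (m ^ i * ω i)) ^ γ := by fun_prop
    rw [lintegral_gapLaw (hmeas (N + 1))]
    calc _ ≤ ∫⁻ s in Set.Ioi 0, (ENNReal.ofReal (1 - m) *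
          (ENNReal.ofReal (Real.exp (-s)) * ENNReal.ofReal (s / (1 - m)) ^ γ) +
          ENNReal.ofReal (Real.exp (-s)) * (ENNReal.ofReal m * I)) := by
          refine lintegral_mono fun s => ?_
          rw [mul_left_comm, ← mul_add]
          refine mul_le_mul_right ?_ _
          calc _ ≤ ∫⁻ ω, (ENNReal.ofReal (1 - m) * ENNReal.ofReal (s / (1 - m)) ^ γ +
                ENNReal.ofReal m *
                  (∑ i ∈ Finset.range N, ENNReal.ofReal (m ^ i * ω i)) ^ γ) ∂gapLaw := by
                refine lintegral_mono fun ω => ?_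
                have : ∑ i ∈ Finset.range (N + 1), ENNReal.ofReal (m ^ i * seqCons s ω i) =
                    ENNReal.ofReal (1 - m) * ENNReal.ofReal (s / (1 - m)) +
                    ENNReal.ofReal m * ∑ i ∈ Finset.range N, ENNReal.ofReal (m ^ i * ω i) := by
                  rw [Finset.sum_range_succ', add_comm, Finset.mul_sum,
                    ← ENNReal.ofReal_mul h1m.le, mul_div_cancel₀ _ h1m.ne']
                  congr 1
                  · simp [seqCons]
                  · refine Finset.sum_congr rfl fun i _ => ?_
                    rw [← ENNReal.ofReal_mul hm0.le, pow_succ', mul_assoc]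
                    rfl
                simp only
                rw [this]
                exact ENNReal.rpow_arith_mean_le_arith_mean2_rpow _ _ _ _ hw hγ
            _ = _ := by
                rw [lintegral_add_left measurable_const, lintegral_const, measure_univ, mul_one,
                  lintegral_const_mul _ (hmeas N)]
      _ = ENNReal.ofReal (1 - m) * B + ENNReal.ofReal m * I := by
          rw [lintegral_add_left (by fun_prop), lintegral_const_mul _ (by fun_prop),
            lintegral_mul_const _ (by fun_prop), hone, one_mul]
      _ ≤ ENNReal.ofReal (1 - m) * B + ENNReal.ofReal m * B := by gcongr
      _ = B := by rw [← add_mul, hw, one_mul]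

theorem lintegral_exp_neg_mul_rpow_lt_top {c γ : ℝ} (hc : 0 < c) (hγ : -1 < γ) :
    ∫⁻ s in Set.Ioi 0, ENNReal.ofReal (Real.exp (-s)) * ENNReal.ofReal (s / c) ^ γ < ∞ := by
  have h1 : ∀ s ∈ Set.Ioi (0 : ℝ), ENNReal.ofReal (Real.exp (-s)) * ENNReal.ofReal (s / c) ^ γ =
      ENNReal.ofReal ((1 / c) ^ γ * (Real.exp (-s) * s ^ (γ + 1 - 1))) := by
    intro s hs
    have hs' : 0 < s := hs
    rw [ENNReal.ofReal_rpow_of_pos (by positivity), ← ENNReal.ofReal_mul (Real.exp_pos _).le,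
      div_eq_mul_one_div, Real.mul_rpow hs'.le (by positivity), add_sub_cancel_right]
    congr 1
    ring
  rw [setLIntegral_congr_fun measurableSet_Ioi h1]
  have := ((Real.GammaIntegral_convergent (s := γ + 1) (by linarith)).const_mul
    ((1 / c) ^ γ)).2
  exact (lintegral_ofReal_le_lintegral_enorm _).trans_lt this

theorem lintegral_resetLimit_rpow_lt_top_of_one_le {m : ℝ} (hm0 : 0 < m) (hm1 : m < 1) {γ : ℝ}
    (hγ : 1 ≤ γ) : ∫⁻ ω, resetLimit m ω ^ γ ∂gapLaw < ∞ := by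
  refine lt_of_le_of_lt ?_
    (lintegral_exp_neg_mul_rpow_lt_top (c := 1 - m) (γ := γ) (by linarith) (by linarith))
  have h1 (ω : ℕ → ℝ) : resetLimit m ω ^ γ = liminf (fun N =>
      (∑ i ∈ Finset.range N, ENNReal.ofReal (m ^ i * ω i)) ^ γ) atTop := by
    refine (Tendsto.liminf_eq ?_).symm
    exact (ENNReal.continuous_rpow_const.tendsto _).comp (ENNReal.tendsto_nat_tsum _)
  rw [lintegral_congr h1]
  refine (lintegral_liminf_le fun N => by fun_prop).trans ?_
  refine liminf_le_of_le (by isBoundedDefault) fun b hb => ?_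
  obtain ⟨N, hN⟩ := hb.exists
  exact hN.trans (lintegral_rpow_partial_le hm0 hm1 hγ N)

/-- With n resets before time 1 the process is at least m^n, so the moment is at most e^{-1} ∑
(m^γ)^n/n!, an exponential series. -/
theorem lintegral_resetProc_one_rpow_lt_top {m : ℝ} (hm0 : 0 < m) (hm1 : m < 1) {γ : ℝ}
    (hγ : γ ≤ 0) : ∫⁻ ω, resetProc m 1 ω ^ γ ∂gapLaw < ∞ := by
  rw [lintegral_resetProc hm0.le zero_le_one (f := fun x => x ^ γ) (by fun_prop)]
  refine ENNReal.mul_lt_top ENNReal.ofReal_lt_top ?_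
  have h1 (n : ℕ) : resetInt m n 1 (fun x => x ^ γ) ≤
      ENNReal.ofReal ((m ^ γ) ^ n / n !) := by
    refine (resetInt_le hm0 hm1 n zero_le_one (C := ENNReal.ofReal (m ^ n) ^ γ) ?_).trans ?_
    · intro x hx
      rw [mul_one] at hx
      exact ennreal_rpow_le_rpow_of_nonpos hγ hx
    · rw [ENNReal.ofReal_rpow_of_pos (pow_pos hm0 n), ← ENNReal.ofReal_mul (by positivity)]
      refine ENNReal.ofReal_le_ofReal (le_of_eq ?_)
      rw [one_pow, mul_one_div, ← Real.rpow_natCast, ← Real.rpow_natCast, ← Real.rpow_mul hm0.le,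
        ← Real.rpow_mul hm0.le, mul_comm]
  refine (ENNReal.tsum_le_tsum h1).trans_lt ?_
  rw [← ENNReal.ofReal_tsum_of_nonneg (fun n => by positivity)
    (Real.summable_pow_div_factorial _)]
  exact ENNReal.ofReal_lt_top

theorem lintegral_resetLimit_rpow_lt_top {m : ℝ} (hm0 : 0 < m) (hm1 : m < 1) (γ : ℝ) :
    ∫⁻ ω, resetLimit m ω ^ γ ∂gapLaw < ∞ := by
  rcases le_total γ 0 with hγ | hγ
  · refine lt_of_le_of_lt (lintegral_mono_ae ?_) (lintegral_resetProc_one_rpow_lt_top hm0 hm1 hγ)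
    filter_upwards [ae_gapLaw_pos] with ω hω
    exact ennreal_rpow_le_rpow_of_nonpos hγ (resetProc_le_resetLimit hm0.le hω 1)
  · refine lt_of_le_of_lt (lintegral_mono (g := fun ω => 1 + resetLimit m ω ^ (γ + 1)) ?_) ?_
    · intro ω
      rcases le_total (resetLimit m ω) 1 with h | h
      · exact (ENNReal.rpow_le_one h hγ).trans le_self_add
      · exact (ENNReal.rpow_le_rpow_of_exponent_le h (by linarith)).trans le_add_self
    · rw [lintegral_add_left measurable_const]
      exact ENNReal.add_lt_top.2 ⟨by simp,
        lintegral_resetLimit_rpow_lt_top_of_one_le hm0 hm1 (by linarith)⟩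

theorem ae_resetLimit_lt_top {m : ℝ} (hm0 : 0 < m) (hm1 : m < 1) :
    ∀ᵐ ω ∂gapLaw, resetLimit m ω < ∞ := by
  have := lintegral_resetLimit_rpow_lt_top hm0 hm1 1
  simp only [ENNReal.rpow_one] at this
  exact ae_lt_top (measurable_resetLimit m) this.ne

theorem ae_resetLimit_pos (m : ℝ) : ∀ᵐ ω ∂gapLaw, 0 < resetLimit m ω := by
  filter_upwards [ae_gapLaw_pos] with ω hω
  refine lt_of_lt_of_le ?_ (ENNReal.le_tsum 0)
  simpa using hω 0

/-- By monotonicity in t, the value at time 1 dominates for γ ≤ 0 and the limit dominates for γ ≥ 0.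
-/
theorem tendsto_lintegral_resetProc_rpow {m : ℝ} (hm0 : 0 < m) (hm1 : m < 1) (γ : ℝ) :
    Tendsto (fun t => ∫⁻ ω, resetProc m t ω ^ γ ∂gapLaw) atTop
      (𝓝 (∫⁻ ω, resetLimit m ω ^ γ ∂gapLaw)) := by
  have hlim : ∀ᵐ ω ∂gapLaw, Tendsto (fun t => resetProc m t ω ^ γ) atTop
      (𝓝 (resetLimit m ω ^ γ)) := by
    filter_upwards [ae_gapLaw_pos] with ω hω
    exact (ENNReal.continuous_rpow_const.tendsto _).comp (tendsto_resetProc hm0.le hω)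
  rcases le_total γ 0 with hγ | hγ
  · refine tendsto_lintegral_filter_of_dominated_convergence (fun ω => resetProc m 1 ω ^ γ)
      (Filter.Eventually.of_forall fun t => by fun_prop) ?_
      (lintegral_resetProc_one_rpow_lt_top hm0 hm1 hγ).ne hlim
    filter_upwards [eventually_ge_atTop 1] with t ht
    filter_upwards [ae_gapLaw_pos] with ω hω
    exact ennreal_rpow_le_rpow_of_nonpos hγ (resetProc_mono hm0.le hω ht)
  · refine tendsto_lintegral_filter_of_dominated_convergence (fun ω => resetLimit m ω ^ γ)
      (Filter.Eventually.of_forall fun t => by fun_prop) ?_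
      (lintegral_resetLimit_rpow_lt_top hm0 hm1 γ).ne hlim
    refine Filter.Eventually.of_forall fun t => ?_
    filter_upwards [ae_gapLaw_pos] with ω hω
    exact ENNReal.rpow_le_rpow (resetProc_le_resetLimit hm0.le hω t) hγ

/-! ### The moment function and its functional equation. -/

/-- The real moments of the limit law. -/
def limitMoment (m γ : ℝ) : ℝ := (∫⁻ ω, resetLimit m ω ^ γ ∂gapLaw).toReal

theorem ae_toReal_rpow_eq_exp {m : ℝ} (hm0 : 0 < m) (hm1 : m < 1) (γ : ℝ) :
    ∀ᵐ ω ∂gapLaw, (resetLimit m ω ^ γ).toReal =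
      Real.exp (γ * Real.log (resetLimit m ω).toReal) := by
  filter_upwards [ae_resetLimit_pos m, ae_resetLimit_lt_top hm0 hm1] with ω h0 h1
  rw [← ENNReal.toReal_rpow, Real.rpow_def_of_pos (ENNReal.toReal_pos h0.ne' h1.ne), mul_comm]

theorem integrable_exp_mul_log_resetLimit {m : ℝ} (hm0 : 0 < m) (hm1 : m < 1) (γ : ℝ) :
    Integrable (fun ω => Real.exp (γ * Real.log (resetLimit m ω).toReal)) gapLaw :=
  (integrable_toReal_of_lintegral_ne_top (by fun_prop)
    (lintegral_resetLimit_rpow_lt_top hm0 hm1 γ).ne).congr (ae_toReal_rpow_eq_exp hm0 hm1 γ)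

/-- Viewing moments of X as the moment generating function of log X yields continuity and positivity
in γ. -/
theorem limitMoment_eq_mgf {m : ℝ} (hm0 : 0 < m) (hm1 : m < 1) (γ : ℝ) :
    limitMoment m γ = mgf (fun ω => Real.log (resetLimit m ω).toReal) gapLaw γ := by
  rw [limitMoment, mgf, ← integral_congr_ae (ae_toReal_rpow_eq_exp hm0 hm1 γ), integral_toReal
    (by fun_prop) (ae_lt_top (by fun_prop) (lintegral_resetLimit_rpow_lt_top hm0 hm1 γ).ne)]

theorem continuous_limitMoment {m : ℝ} (hm0 : 0 < m) (hm1 : m < 1) :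
    Continuous (limitMoment m) := by
  rw [funext (limitMoment_eq_mgf hm0 hm1)]
  exact continuous_mgf (integrable_exp_mul_log_resetLimit hm0 hm1)

theorem limitMoment_pos {m : ℝ} (hm0 : 0 < m) (hm1 : m < 1) (γ : ℝ) : 0 < limitMoment m γ := by
  rw [limitMoment_eq_mgf hm0 hm1]
  exact mgf_pos (integrable_exp_mul_log_resetLimit hm0 hm1 γ)

theorem limitMoment_zero (m : ℝ) : limitMoment m 0 = 1 := by
  simp [limitMoment]

/-- Hölder's inequality; this is the log-convexity needed for Bohr–Mollerup. -/
theorem limitMoment_le {m : ℝ} (hm0 : 0 < m) (hm1 : m < 1) (x y : ℝ) {a b : ℝ} (ha : 0 ≤ a)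
    (hb : 0 ≤ b) (hab : a + b = 1) :
    limitMoment m (a * x + b * y) ≤ limitMoment m x ^ a * limitMoment m y ^ b := by
  rw [limitMoment, limitMoment, limitMoment, ENNReal.toReal_rpow, ENNReal.toReal_rpow,
    ← ENNReal.toReal_mul]
  refine ENNReal.toReal_mono (ENNReal.mul_ne_top
    (ENNReal.rpow_ne_top_of_nonneg ha (lintegral_resetLimit_rpow_lt_top hm0 hm1 x).ne)
    (ENNReal.rpow_ne_top_of_nonneg hb (lintegral_resetLimit_rpow_lt_top hm0 hm1 y).ne)) ?_
  refine le_trans (le_of_eq (lintegral_congr_ae ?_)) (ENNReal.lintegral_mul_norm_pow_le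
    (f := fun ω => resetLimit m ω ^ x) (g := fun ω => resetLimit m ω ^ y)
    (by fun_prop) (by fun_prop) ha hb hab)
  filter_upwards [ae_resetLimit_pos m, ae_resetLimit_lt_top hm0 hm1] with ω h0 h1
  rw [← ENNReal.rpow_mul, ← ENNReal.rpow_mul, ← ENNReal.rpow_add _ _ h0.ne' h1.ne, mul_comm a,
    mul_comm b]

theorem integrableOn_exp_neg_mul_add_rpow (γ : ℝ) {z : ℝ} (hz : 0 < z) :
    IntegrableOn (fun s => Real.exp (-s) * (s + z) ^ γ) (Set.Ioi 0) := by
  refine integrable_of_isBigO_exp_neg (b := 1 / 2) (by norm_num) ?_ ?_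
  · refine ContinuousOn.mul (by fun_prop) (ContinuousOn.rpow_const (by fun_prop) fun s hs => ?_)
    have : 0 ≤ s := hs
    exact Or.inl (by positivity)
  -- The integrand is e^z times the Gamma integrand at s + z.
  · have h1 := ((Real.Gamma_integrand_isLittleO γ).comp_tendsto
      (tendsto_atTop_add_const_right atTop z tendsto_id)).isBigO
    have h2 := h1.const_mul_left (Real.exp z)
    refine (h2.congr_left fun s => ?_).trans ?_
    · simp only [Function.comp_apply, id]
      rw [← mul_assoc, ← Real.exp_add]
      congr 2
      ring
    · refine Asymptotics.IsBigO.of_bound 1 (Filter.Eventually.of_forall fun s => ?_)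
      simp only [Function.comp_apply, id, Real.norm_eq_abs, Real.abs_exp, one_mul]
      exact Real.exp_le_exp.2 (by linarith)

theorem tendsto_exp_neg_mul_add_rpow (γ z : ℝ) :
    Tendsto (fun s => Real.exp (-s) * (s + z) ^ γ) atTop (𝓝 0) := by
  have h1 := (Real.Gamma_integrand_isLittleO γ).isBigO.trans_tendsto
    (g'' := fun x => Real.exp (-(1 / 2) * x))  (by
      refine Real.tendsto_exp_atBot.comp ?_
      exact tendsto_id.const_mul_atTop_of_neg (by norm_num))
  have h2 := (h1.comp (tendsto_atTop_add_const_right atTop z tendsto_id)).const_mul (Real.exp z)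
  rw [mul_zero] at h2
  refine h2.congr fun s => ?_
  simp only [Function.comp_apply, id]
  rw [← mul_assoc, ← Real.exp_add]
  congr 2
  ring

theorem integral_exp_neg_mul_add_rpow (γ : ℝ) {z : ℝ} (hz : 0 < z) :
    ∫ s in Set.Ioi 0, Real.exp (-s) * (s + z) ^ γ =
      z ^ γ + γ * ∫ s in Set.Ioi 0, Real.exp (-s) * (s + z) ^ (γ - 1) := by
  have hderiv : ∀ s ∈ Set.Ici (0 : ℝ), HasDerivAt (fun s => -(Real.exp (-s) * (s + z) ^ γ))
      (Real.exp (-s) * (s + z) ^ γ - γ * (Real.exp (-s) * (s + z) ^ (γ - 1))) s := by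
    intro s hs
    have hs' : 0 ≤ s := hs
    have hsz : s + z ≠ 0 := by positivity
    have h1 : HasDerivAt (fun s : ℝ => Real.exp (-s)) (-Real.exp (-s)) s := by
      simpa using (hasDerivAt_id s).neg.exp
    have h2 : HasDerivAt (fun s : ℝ => (s + z) ^ γ) (γ * (s + z) ^ (γ - 1)) s := by
      simpa using ((hasDerivAt_id s).add_const z).rpow_const (p := γ) (Or.inl hsz)
    refine (h1.mul h2).neg.congr_deriv ?_
    ring
  have h0 := integrableOn_exp_neg_mul_add_rpow γ hz
  have h1 := (integrableOn_exp_neg_mul_add_rpow (γ - 1) hz).const_mul γ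
  have h := integral_Ioi_of_hasDerivAt_of_tendsto' hderiv (h0.sub h1)
    (m := 0) (by simpa using (tendsto_exp_neg_mul_add_rpow γ z).neg)
  rw [integral_sub h0 h1, integral_const_mul] at h
  simp only [neg_zero, Real.exp_zero, zero_add, one_mul, sub_neg_eq_add] at h
  linarith

/-- Integration by parts in [0, ∞]. To avoid subtraction, the term with coefficient γ appears on
both sides through its negative and positive parts, at most one of which is nonzero. -/
theorem lintegral_exp_neg_mul_add_rpow (γ : ℝ) {z : ℝ≥0∞} (hz : 0 < z) (hz' : z < ∞) :
    (∫⁻ s in Set.Ioi 0, ENNReal.ofReal (Real.exp (-s)) * (ENNReal.ofReal s + z) ^ γ) +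
      ENNReal.ofReal (-γ) * ∫⁻ s in Set.Ioi 0,
        ENNReal.ofReal (Real.exp (-s)) * (ENNReal.ofReal s + z) ^ (γ - 1) =
    z ^ γ + ENNReal.ofReal γ * ∫⁻ s in Set.Ioi 0,
        ENNReal.ofReal (Real.exp (-s)) * (ENNReal.ofReal s + z) ^ (γ - 1) := by
  obtain ⟨x, hx, rfl⟩ : ∃ x : ℝ, 0 < x ∧ z = ENNReal.ofReal x :=
    ⟨z.toReal, ENNReal.toReal_pos hz.ne' hz'.ne, (ENNReal.ofReal_toReal hz'.ne).symm⟩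
  have hnn (δ : ℝ) : ∀ s ∈ Set.Ioi (0 : ℝ), 0 ≤ Real.exp (-s) * (s + x) ^ δ := by
    intro s hs
    have : 0 < s := hs
    positivity
  have hconv (δ : ℝ) : ∫⁻ s in Set.Ioi 0, ENNReal.ofReal (Real.exp (-s)) *
      (ENNReal.ofReal s + ENNReal.ofReal x) ^ δ =
      ENNReal.ofReal (∫ s in Set.Ioi 0, Real.exp (-s) * (s + x) ^ δ) := by
    rw [ofReal_integral_eq_lintegral_ofReal (integrableOn_exp_neg_mul_add_rpow δ hx)
      ((ae_restrict_iff' measurableSet_Ioi).2 (Filter.Eventually.of_forall (hnn δ)))]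
    refine setLIntegral_congr_fun measurableSet_Ioi fun s hs => ?_
    have hs' : 0 < s := hs
    rw [← ENNReal.ofReal_add hs'.le hx.le, ENNReal.ofReal_rpow_of_pos (by positivity),
      ← ENNReal.ofReal_mul (Real.exp_pos _).le]
  have hI (δ : ℝ) : 0 ≤ ∫ s in Set.Ioi 0, Real.exp (-s) * (s + x) ^ δ :=
    setIntegral_nonneg measurableSet_Ioi (hnn δ)
  rw [hconv, hconv, ENNReal.ofReal_rpow_of_pos hx]
  have key := integral_exp_neg_mul_add_rpow γ hx
  rcases le_total γ 0 with h | h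
  · rw [ENNReal.ofReal_of_nonpos h, zero_mul, add_zero,
      ← ENNReal.ofReal_mul (neg_nonneg.2 h),
      ← ENNReal.ofReal_add (hI γ) (mul_nonneg (neg_nonneg.2 h) (hI _))]
    congr 1
    linarith
  · rw [ENNReal.ofReal_of_nonpos (neg_nonpos.2 h), zero_mul, add_zero,
      ← ENNReal.ofReal_mul h, ← ENNReal.ofReal_add (by positivity) (mul_nonneg h (hI _)), key]

/-- The functional equation of the moments, from the stationarity of the limit law. -/
theorem limitMoment_functional_eq {m : ℝ} (hm0 : 0 < m) (hm1 : m < 1) (γ : ℝ) :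
    (1 - m ^ γ) * limitMoment m γ = γ * limitMoment m (γ - 1) := by
  have hstat (δ : ℝ) : ∫⁻ ω, resetLimit m ω ^ δ ∂gapLaw = ∫⁻ ω, (∫⁻ s in Set.Ioi 0,
      ENNReal.ofReal (Real.exp (-s)) *
        (ENNReal.ofReal s + ENNReal.ofReal m * resetLimit m ω) ^ δ) ∂gapLaw := by
    rw [lintegral_resetLimit hm0.le (f := fun x => x ^ δ) (by fun_prop),
      lintegral_lintegral_swap (by fun_prop)]
    refine lintegral_congr fun s => ?_
    rw [lintegral_const_mul _ (by fun_prop)]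
  have hmeas (δ : ℝ) : Measurable fun ω => ∫⁻ s in Set.Ioi 0,
      ENNReal.ofReal (Real.exp (-s)) *
        (ENNReal.ofReal s + ENNReal.ofReal m * resetLimit m ω) ^ δ :=
    Measurable.lintegral_prod_right' (f := fun p : (ℕ → ℝ) × ℝ => ENNReal.ofReal (Real.exp (-p.2)) *
        (ENNReal.ofReal p.2 + ENNReal.ofReal m * resetLimit m p.1) ^ δ) (by fun_prop)
  -- Integration by parts in the first gap with z = mX, averaged over X; the boundary term is m^γ
  -- X^γ.
  have key : ∫⁻ ω, resetLimit m ω ^ γ ∂gapLaw +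
      ENNReal.ofReal (-γ) * ∫⁻ ω, resetLimit m ω ^ (γ - 1) ∂gapLaw =
      ENNReal.ofReal (m ^ γ) * ∫⁻ ω, resetLimit m ω ^ γ ∂gapLaw +
      ENNReal.ofReal γ * ∫⁻ ω, resetLimit m ω ^ (γ - 1) ∂gapLaw := by
    nth_rw 1 [hstat γ]
    rw [hstat (γ - 1), ← lintegral_const_mul _ (hmeas _), ← lintegral_const_mul _ (hmeas _),
      ← lintegral_const_mul _ (by fun_prop), ← lintegral_add_left (hmeas _),
      ← lintegral_add_left (by fun_prop)]
    refine lintegral_congr_ae ?_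
    filter_upwards [ae_resetLimit_pos m, ae_resetLimit_lt_top hm0 hm1] with ω h0 h1
    rw [lintegral_exp_neg_mul_add_rpow γ
      (ENNReal.mul_pos (ENNReal.ofReal_pos.2 hm0).ne' h0.ne')
      (ENNReal.mul_lt_top ENNReal.ofReal_lt_top h1),
      ENNReal.mul_rpow_of_ne_top ENNReal.ofReal_ne_top h1.ne, ENNReal.ofReal_rpow_of_pos hm0]
  have h1 := (lintegral_resetLimit_rpow_lt_top hm0 hm1 γ).ne
  have h2 := (lintegral_resetLimit_rpow_lt_top hm0 hm1 (γ - 1)).ne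
  have key' := congrArg ENNReal.toReal key
  rw [ENNReal.toReal_add h1 (ENNReal.mul_ne_top ENNReal.ofReal_ne_top h2),
    ENNReal.toReal_add (ENNReal.mul_ne_top ENNReal.ofReal_ne_top h1)
      (ENNReal.mul_ne_top ENNReal.ofReal_ne_top h2), ENNReal.toReal_mul, ENNReal.toReal_mul,
    ENNReal.toReal_mul, ENNReal.toReal_ofReal (Real.rpow_pos_of_pos hm0 γ).le] at key'
  change limitMoment m γ + _ * limitMoment m (γ - 1) =
    m ^ γ * limitMoment m γ + _ * limitMoment m (γ - 1) at key'
  rcases le_total γ 0 with h | h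
  · rw [ENNReal.ofReal_of_nonpos h, ENNReal.toReal_ofReal (neg_nonneg.2 h),
      ENNReal.toReal_zero] at key'
    linarith
  · rw [ENNReal.ofReal_of_nonpos (neg_nonpos.2 h), ENNReal.toReal_ofReal h,
      ENNReal.toReal_zero] at key'
    linarith

/-! ### Moments of integer order. -/

theorem limitMoment_natCast {m : ℝ} (hm0 : 0 < m) (hm1 : m < 1) (k : ℕ) :
    limitMoment m k = (k ! : ℝ) / qPoch m m k := by
  induction k with
  | zero => simp [limitMoment_zero, qPoch]
  | succ k ih =>
    have h := limitMoment_functional_eq hm0 hm1 ((k + 1 : ℕ) : ℝ)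
    have h1 : 0 < 1 - m ^ (k + 1) := one_sub_pow_pos hm0 hm1 k
    rw [Real.rpow_natCast, Nat.cast_add_one, add_sub_cancel_right, ih] at h
    have hq : qPoch m m (k + 1) = qPoch m m k * (1 - m ^ (k + 1)) := by
      rw [qPoch, Finset.prod_range_succ, qPoch, pow_succ']
    rw [Nat.cast_add_one, hq, Nat.factorial_succ, ← div_div, eq_div_iff h1.ne', mul_comm, h]
    push_cast
    ring

/-- At γ = 0 the functional equation degenerates to 0 = 0. Dividing by γ and letting γ → 0, the
factor (1 - m^γ)/γ tends to -log m, and the moments are continuous. -/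
theorem limitMoment_neg_one {m : ℝ} (hm0 : 0 < m) (hm1 : m < 1) :
    limitMoment m (-1) = Real.log (1 / m) := by
  have hd : HasDerivAt (fun γ : ℝ => m ^ γ) (Real.log m) 0 := by
    simpa using (Real.hasStrictDerivAt_const_rpow hm0 0).hasDerivAt
  have h1 := hasDerivAt_iff_tendsto_slope.1 hd
  have h2 : Tendsto (fun γ => -slope (fun γ : ℝ => m ^ γ) 0 γ * limitMoment m γ) (𝓝[≠] 0)
      (𝓝 (-Real.log m * limitMoment m 0)) :=
    h1.neg.mul ((continuous_limitMoment hm0 hm1).tendsto 0 |>.mono_left nhdsWithin_le_nhds)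
  have h3 : Tendsto (fun γ => limitMoment m (γ - 1)) (𝓝[≠] 0) (𝓝 (limitMoment m (0 - 1))) :=
    (((continuous_limitMoment hm0 hm1).comp (continuous_id.sub continuous_const)).tendsto
      0).mono_left nhdsWithin_le_nhds
  have h4 : (fun γ => -slope (fun γ : ℝ => m ^ γ) 0 γ * limitMoment m γ) =ᶠ[𝓝[≠] 0]
      fun γ => limitMoment m (γ - 1) := by
    filter_upwards [self_mem_nhdsWithin] with γ hγ
    have hγ' : γ ≠ 0 := hγ
    have := limitMoment_functional_eq hm0 hm1 γ
    rw [slope_def_field, Real.rpow_zero, sub_zero]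
    field_simp
    linarith
  have := tendsto_nhds_unique (h2.congr' h4) h3
  rw [limitMoment_zero, mul_one, zero_sub] at this
  rw [← this, one_div, Real.log_inv]

theorem limitMoment_neg_natCast {m : ℝ} (hm0 : 0 < m) (hm1 : m < 1) {n : ℕ} (hn : 1 ≤ n) :
    limitMoment m (-(n : ℝ)) =
      (∏ k ∈ Finset.Ico 1 n, (1 - m ^ ((k : ℝ) + -(n : ℝ))) / ((k : ℝ) + -(n : ℝ)))
        * Real.log (1 / m) := by
  induction n, hn using Nat.le_induction with
  | base => simpa using limitMoment_neg_one hm0 hm1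
  | succ n hn ih =>
    have h := limitMoment_functional_eq hm0 hm1 (-(n : ℝ))
    have hn0 : (n : ℝ) ≠ 0 := Nat.cast_ne_zero.2 (by omega)
    -- The factors depend only on k - n, so shifting k leaves one new factor, the one at k = 1.
    have hprod : ∏ k ∈ Finset.Ico 1 (n + 1),
        (1 - m ^ ((k : ℝ) + -((n + 1 : ℕ) : ℝ))) / ((k : ℝ) + -((n + 1 : ℕ) : ℝ)) =
        (1 - m ^ (-(n : ℝ))) / (-(n : ℝ)) *
        ∏ k ∈ Finset.Ico 1 n, (1 - m ^ ((k : ℝ) + -(n : ℝ))) / ((k : ℝ) + -(n : ℝ)) := by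
      rw [Finset.prod_eq_prod_Ico_succ_bot (by omega), ← Finset.prod_Ico_add' _ 1 n 1]
      congr 1
      · have e : ((1 : ℕ) : ℝ) + -((n + 1 : ℕ) : ℝ) = -(n : ℝ) := by push_cast; ring
        rw [e]
      · refine Finset.prod_congr rfl fun k _ => ?_
        have e : ((k + 1 : ℕ) : ℝ) + -((n + 1 : ℕ) : ℝ) = (k : ℝ) + -(n : ℝ) := by
          push_cast; ring
        rw [e]
    rw [hprod, mul_assoc, ← ih, div_mul_eq_mul_div, h]
    push_cast
    rw [neg_add', mul_div_cancel_left₀ _ (neg_ne_zero.2 hn0)]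

/-! ### Infinite q-products and the Bohr–Mollerup characterization. -/

theorem summable_mul_pow {m : ℝ} (hm0 : 0 < m) (hm1 : m < 1) (a : ℝ) :
    Summable fun j : ℕ => -(a * m ^ j) :=
  ((summable_geometric_of_lt_one hm0.le hm1).mul_left a).neg

theorem multipliable_qPoch {m : ℝ} (hm0 : 0 < m) (hm1 : m < 1) (a : ℝ) :
    Multipliable fun j : ℕ => 1 - a * m ^ j := by
  simpa only [sub_eq_add_neg] using
    Real.multipliable_one_add_of_summable (summable_mul_pow hm0 hm1 a)

theorem qPochInf_rpow {m : ℝ} (hm0 : 0 < m) (hm1 : m < 1) (x : ℝ) :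
    qPochInf (m ^ x) m = (1 - m ^ x) * qPochInf (m ^ (x + 1)) m := by
  have h (j : ℕ) : 1 - m ^ x * m ^ (j + 1) = 1 - m ^ (x + 1) * m ^ j := by
    rw [Real.rpow_add_one hm0.ne']; ring
  rw [qPochInf, tprod_eq_zero_mul', qPochInf]
  · simp only [h, pow_zero, mul_one]
  · simpa only [h] using multipliable_qPoch hm0 hm1 (m ^ (x + 1))

theorem one_sub_mul_pow_pos {m : ℝ} (hm0 : 0 < m) (hm1 : m < 1) {a : ℝ} (ha0 : 0 ≤ a)
    (ha : a < 1) (j : ℕ) : 0 < 1 - a * m ^ j := by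
  have : m ^ j ≤ 1 := pow_le_one₀ hm0.le hm1.le
  nlinarith [pow_pos hm0 j]

theorem summable_log_qPoch {m : ℝ} (hm0 : 0 < m) (hm1 : m < 1) (a : ℝ) :
    Summable fun j : ℕ => Real.log (1 - a * m ^ j) := by
  simpa only [sub_eq_add_neg] using
    Real.summable_log_one_add_of_summable (summable_mul_pow hm0 hm1 a)

theorem exp_tsum_log_qPoch {m : ℝ} (hm0 : 0 < m) (hm1 : m < 1) {a : ℝ} (ha0 : 0 ≤ a)
    (ha : a < 1) : Real.exp (∑' j : ℕ, Real.log (1 - a * m ^ j)) = qPochInf a m :=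
  Real.rexp_tsum_eq_tprod (one_sub_mul_pow_pos hm0 hm1 ha0 ha) (summable_log_qPoch hm0 hm1 a)

theorem qPochInf_pos {m : ℝ} (hm0 : 0 < m) (hm1 : m < 1) {a : ℝ} (ha0 : 0 ≤ a)
    (ha : a < 1) : 0 < qPochInf a m := by
  rw [← exp_tsum_log_qPoch hm0 hm1 ha0 ha]
  exact Real.exp_pos _

theorem log_qPochInf {m : ℝ} (hm0 : 0 < m) (hm1 : m < 1) {a : ℝ} (ha0 : 0 ≤ a)
    (ha : a < 1) : Real.log (qPochInf a m) = ∑' j : ℕ, Real.log (1 - a * m ^ j) := by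
  rw [← exp_tsum_log_qPoch hm0 hm1 ha0 ha, Real.log_exp]

/-- Each factor 1 - m^{x+j} is concave in x by weighted AM–GM, and log is increasing and concave;
sum over j. -/
theorem concaveOn_log_qPochInf {m : ℝ} (hm0 : 0 < m) (hm1 : m < 1) :
    ConcaveOn ℝ (Set.Ioi 0) fun x : ℝ => Real.log (qPochInf (m ^ x) m) := by
  refine ⟨convex_Ioi 0, fun x hx y hy a b ha hb hab => ?_⟩
  have hlt {z : ℝ} (hz : z ∈ Set.Ioi 0) : m ^ z < 1 := Real.rpow_lt_one hm0.le hm1 hz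
  have hz : a • x + b • y ∈ Set.Ioi 0 := (convex_Ioi (0 : ℝ)) hx hy ha hb hab
  simp only
  rw [log_qPochInf hm0 hm1 (by positivity) (hlt hx), log_qPochInf hm0 hm1 (by positivity) (hlt hy),
    log_qPochInf hm0 hm1 (by positivity) (hlt hz), smul_eq_mul, smul_eq_mul, ← tsum_mul_left,
    ← tsum_mul_left, ← ((summable_log_qPoch hm0 hm1 _).mul_left a).tsum_add
      ((summable_log_qPoch hm0 hm1 _).mul_left b)]
  refine Summable.tsum_le_tsum (fun j => ?_) (((summable_log_qPoch hm0 hm1 _).mul_left a).add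
      ((summable_log_qPoch hm0 hm1 _).mul_left b)) (summable_log_qPoch hm0 hm1 _)
  have hpx := one_sub_mul_pow_pos hm0 hm1 (by positivity) (hlt hx) j
  have hpy := one_sub_mul_pow_pos hm0 hm1 (by positivity) (hlt hy) j
  have hconc := strictConcaveOn_log_Ioi.concaveOn.2 (Set.mem_Ioi.2 hpx) (Set.mem_Ioi.2 hpy)
    ha hb hab
  refine hconc.trans (Real.log_le_log ?_ ?_)
  · exact (convex_Ioi (0 : ℝ)) (Set.mem_Ioi.2 hpx) (Set.mem_Ioi.2 hpy) ha hb hab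
  · have hgm := Real.geom_mean_le_arith_mean2_weighted ha hb (Real.rpow_nonneg hm0.le x)
      (Real.rpow_nonneg hm0.le y) hab
    rw [← Real.rpow_mul hm0.le, ← Real.rpow_mul hm0.le, ← Real.rpow_add hm0, mul_comm x,
      mul_comm y] at hgm
    have := mul_le_mul_of_nonneg_right hgm (pow_pos hm0 j).le
    simp only [smul_eq_mul]
    linarith

/-- The function f(x) = M(x-1) (m;m)_∞/(m^x;m)_∞ is Γ: it is log-convex, f(1) = 1, and the factor 1
- m^y lost by the q-product cancels the one in the functional equation, leaving f(y+1) = y f(y). -/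
theorem limitMoment_eq_of_neg_one_lt {m : ℝ} (hm0 : 0 < m) (hm1 : m < 1) {γ : ℝ} (hγ : -1 < γ) :
    limitMoment m γ = Real.Gamma (γ + 1) * (qPochInf (m ^ (γ + 1)) m / qPochInf m m) := by
  have hlt {z : ℝ} (hz : 0 < z) : m ^ z < 1 := Real.rpow_lt_one hm0.le hm1 hz
  have hQ : 0 < qPochInf m m := qPochInf_pos hm0 hm1 hm0.le hm1
  have hQx {z : ℝ} (hz : 0 < z) : 0 < qPochInf (m ^ z) m :=
    qPochInf_pos hm0 hm1 (by positivity) (hlt hz)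
  have hBM := Real.eq_Gamma_of_log_convex
    (f := fun x => limitMoment m (x - 1) * (qPochInf m m / qPochInf (m ^ x) m)) ?_ ?_ ?_ ?_
    (show γ + 1 ∈ Set.Ioi (0 : ℝ) by simp only [Set.mem_Ioi]; linarith)
  · have hz := hQx (z := γ + 1) (by linarith)
    rw [← hBM]
    simp only [add_sub_cancel_right]
    field_simp
  · refine ⟨convex_Ioi 0, fun x hx y hy a b ha hb hab => ?_⟩
    have hz : a • x + b • y ∈ Set.Ioi 0 := (convex_Ioi (0 : ℝ)) hx hy ha hb hab
    have hlog {z : ℝ} (hz : z ∈ Set.Ioi 0) :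
        Real.log (limitMoment m (z - 1) * (qPochInf m m / qPochInf (m ^ z) m)) =
        Real.log (limitMoment m (z - 1)) + (Real.log (qPochInf m m) -
          Real.log (qPochInf (m ^ z) m)) := by
      rw [Real.log_mul (limitMoment_pos hm0 hm1 _).ne' (div_pos hQ (hQx hz)).ne',
        Real.log_div hQ.ne' (hQx hz).ne']
    simp only [Function.comp_apply]
    rw [hlog hx, hlog hy, hlog hz]
    have h1 := (concaveOn_log_qPochInf hm0 hm1).2 hx hy ha hb hab
    have h2 := Real.log_le_log (limitMoment_pos hm0 hm1 _)
      (limitMoment_le hm0 hm1 (x - 1) (y - 1) ha hb hab)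
    have hp := limitMoment_pos hm0 hm1
    rw [Real.log_mul (Real.rpow_pos_of_pos (hp _) _).ne' (Real.rpow_pos_of_pos (hp _) _).ne',
      Real.log_rpow (hp _), Real.log_rpow (hp _)] at h2
    have h3 : a * (x - 1) + b * (y - 1) = a • x + b • y - 1 := by
      simp only [smul_eq_mul]; linear_combination -hab
    rw [h3] at h2
    have h4 : Real.log (qPochInf m m) =
      a * Real.log (qPochInf m m) + b * Real.log (qPochInf m m) := by
      rw [← add_mul, hab, one_mul]
    simp only [smul_eq_mul] at *
    linarith
  · intro y hy
    simp only [add_sub_cancel_right]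
    have h := limitMoment_functional_eq hm0 hm1 y
    have h1 : 0 < 1 - m ^ y := sub_pos.2 (hlt hy)
    have h2 := hQx (z := y + 1) (by linarith)
    rw [qPochInf_rpow hm0 hm1 y]
    field_simp
    linarith
  · intro y hy
    exact mul_pos (limitMoment_pos hm0 hm1 _) (div_pos hQ (hQx hy))
  · simp only [sub_self, limitMoment_zero, Real.rpow_one, one_mul]
    exact div_self hQ.ne'

/-- Descent in unit steps from γ > -1. Excluding negative integers keeps γ + 1 nonzero, so the
functional equation can be solved for M(γ). -/
theorem limitMoment_eq {m : ℝ} (hm0 : 0 < m) (hm1 : m < 1) {γ : ℝ}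
    (hγ : ¬ ∃ n : ℕ, 1 ≤ n ∧ γ = -(n : ℝ)) :
    limitMoment m γ = Real.Gamma (γ + 1) * (qPochInf (m ^ (γ + 1)) m / qPochInf m m) := by
  obtain ⟨N, hN⟩ := exists_nat_gt (-1 - γ)
  induction N generalizing γ with
  | zero => exact limitMoment_eq_of_neg_one_lt hm0 hm1 (by simp at hN; linarith)
  | succ N ih =>
    have hne : γ + 1 ≠ 0 := fun h => hγ ⟨1, le_rfl, by push_cast; linarith⟩
    have h1 := ih (γ := γ + 1) (by
      rintro ⟨n, hn, h⟩
      exact hγ ⟨n + 1, by omega, by push_cast; linarith⟩) (by push_cast at hN; linarith)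
    have h2 := limitMoment_functional_eq hm0 hm1 (γ + 1)
    rw [add_sub_cancel_right, h1, Real.Gamma_add_one hne] at h2
    rw [qPochInf_rpow hm0 hm1 (γ + 1)]
    refine mul_left_cancel₀ hne ?_
    rw [← h2]
    ring

theorem limitMoment_eq_gammaQuot {m : ℝ} (hm0 : 0 < m) (hm1 : m < 1) (γ : ℝ) :
    limitMoment m γ = gammaQuot m γ * (1 - m) ^ (-γ) := by
  have h1m : 0 < 1 - m := by linarith
  have hp : (0 : ℝ) < (1 - m) ^ (-γ) := Real.rpow_pos_of_pos h1m _
  rw [gammaQuot]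
  split_ifs with h
  · obtain ⟨n, hn, rfl⟩ := h
    rw [abs_neg, Nat.abs_cast, Nat.floor_natCast, limitMoment_neg_natCast hm0 hm1 hn]
    have : (1 - m) ^ (-(n : ℝ)) * (1 - m) ^ (-(-(n : ℝ))) = 1 := by
      rw [← Real.rpow_add h1m, add_neg_cancel, Real.rpow_zero]
    linear_combination (-((∏ k ∈ Finset.Ico 1 n,
      (1 - m ^ ((k : ℝ) + -(n : ℝ))) / ((k : ℝ) + -(n : ℝ))) * Real.log (1 / m))) * this
  · rw [limitMoment_eq hm0 hm1 h, qGamma, show 1 - (γ + 1) = -γ by ring, div_mul_eq_mul_div,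
      mul_comm (Real.Gamma (γ + 1)) ((1 - m) ^ (-γ)), mul_div_mul_left _ _ hp.ne', div_div_eq_mul_div,
      mul_div_assoc]

/-! ### Determinacy of the moment problem. -/

/-- Two finite laws with exponential moments and the same integer moments coincide. -/
theorem map_eq_map_of_moments_eq {Ω : Type*} [MeasurableSpace Ω] {X : Ω → ℝ} (hX : Measurable X)
    {μ ν : Measure Ω} [IsFiniteMeasure μ] [IsFiniteMeasure ν]
    (hμ : 0 ∈ interior (integrableExpSet X μ)) (hν : 0 ∈ interior (integrableExpSet X ν))
    (h : ∀ n : ℕ, ∫ ω, X ω ^ n ∂μ = ∫ ω, X ω ^ n ∂ν) : μ.map X = ν.map X := by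
  set U : Set ℂ := {z | z.re ∈ interior (integrableExpSet X μ) ∩ interior (integrableExpSet X ν)}
    with hU
  have h0 : (0 : ℂ) ∈ U := ⟨by simpa using hμ, by simpa using hν⟩
  have hder (n : ℕ) :
      iteratedDeriv n (complexMGF X μ) 0 = iteratedDeriv n (complexMGF X ν) 0 := by
    rw [iteratedDeriv_complexMGF (by simpa using hμ), iteratedDeriv_complexMGF (by simpa using hν)]
    simp only [zero_mul, Complex.exp_zero, mul_one, ← Complex.ofReal_pow]
    rw [integral_complex_ofReal, integral_complex_ofReal, h n]
  -- The difference of the two transforms has vanishing Taylor series at 0. The strip U is convex,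
  -- hence connected, and contains the imaginary axis, so the characteristic functions agree.
  have hs := (analyticAt_complexMGF (X := X) (μ := μ) (z := 0)
    (by simpa using hμ)).hasFPowerSeriesAt.sub
      (analyticAt_complexMGF (X := X) (μ := ν) (z := 0) (by simpa using hν)).hasFPowerSeriesAt
  simp only [hder, sub_self] at hs
  have heq : complexMGF X μ =ᶠ[𝓝 0] complexMGF X ν :=
    hs.eventually_eq_zero.mono fun z hz => sub_eq_zero.1 hz
  have hpre : IsPreconnected U :=
    ((convex_integrableExpSet.interior.inter
      convex_integrableExpSet.interior).linear_preimage Complex.reLm).isPreconnected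
  have hEq := AnalyticOnNhd.eqOn_of_preconnected_of_eventuallyEq
    (analyticOnNhd_complexMGF.mono fun z hz => hz.1)
    (analyticOnNhd_complexMGF.mono fun z hz => hz.2) hpre h0 heq
  refine Measure.ext_of_charFun (funext fun t => ?_)
  rw [← complexMGF_mul_I hX.aemeasurable, ← complexMGF_mul_I hX.aemeasurable]
  refine hEq ⟨?_, ?_⟩
  · simpa using hμ
  · simpa using hν

theorem pow_le_qPoch {m : ℝ} (hm0 : 0 < m) (hm1 : m < 1) (k : ℕ) :
    (1 - m) ^ k ≤ qPoch m m k := by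
  rw [qPoch, Finset.pow_eq_prod_const]
  refine Finset.prod_le_prod (fun _ _ => by linarith) fun j _ => ?_
  have : m ^ j ≤ 1 := pow_le_one₀ hm0.le hm1.le
  nlinarith

/-- The k-th moment is at most k!/(1-m)^k, so half the critical rate 1 - m bounds the k-th term of
the exponential series by 2^{-k}. -/
theorem lintegral_exp_lt_top_of_moments {m : ℝ} (hm0 : 0 < m) (hm1 : m < 1) {ν : Measure ℝ≥0}
    (hν : ∀ k : ℕ, ∫⁻ u, (u : ℝ≥0∞) ^ k ∂ν = ENNReal.ofReal ((k ! : ℝ) / qPoch m m k)) :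
    ∫⁻ u : ℝ≥0, ENNReal.ofReal (Real.exp ((1 - m) / 2 * u)) ∂ν < ∞ := by
  have h1m : 0 < 1 - m := by linarith
  have hexp (u : ℝ≥0) : ENNReal.ofReal (Real.exp ((1 - m) / 2 * u)) =
      ∑' k : ℕ, ENNReal.ofReal (((1 - m) / 2) ^ k / k !) * (u : ℝ≥0∞) ^ k := by
    rw [Real.exp_eq_exp_ℝ, NormedSpace.exp_eq_tsum_div, ENNReal.ofReal_tsum_of_nonneg
      (fun k => by positivity) (Real.summable_pow_div_factorial _)]
    refine tsum_congr fun k => ?_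
    rw [mul_pow, mul_div_right_comm, ENNReal.ofReal_mul (by positivity),
      ENNReal.ofReal_pow u.coe_nonneg, ENNReal.ofReal_coe_nnreal]
  simp only [hexp]
  rw [lintegral_tsum fun k => by fun_prop]
  have hle (k : ℕ) : ∫⁻ u : ℝ≥0, ENNReal.ofReal (((1 - m) / 2) ^ k / k !) * (u : ℝ≥0∞) ^ k ∂ν ≤
      ENNReal.ofReal ((1 / 2) ^ k) := by
    rw [lintegral_const_mul _ (by fun_prop), hν, ← ENNReal.ofReal_mul (by positivity)]
    refine ENNReal.ofReal_le_ofReal ?_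
    have hq : 0 < qPoch m m k := (pow_pos h1m k).trans_le (pow_le_qPoch hm0 hm1 k)
    rw [div_mul_div_cancel₀ (by positivity), div_le_iff₀ hq, div_pow, one_div_pow,
      div_eq_mul_one_div, mul_comm]
    gcongr
    exact pow_le_qPoch hm0 hm1 k
  refine (ENNReal.tsum_le_tsum hle).trans_lt ?_
  rw [← ENNReal.ofReal_tsum_of_nonneg (fun k => by positivity)
    (summable_geometric_of_lt_one (by norm_num) (by norm_num))]
  exact ENNReal.ofReal_lt_top

theorem zero_mem_interior_integrableExpSet {m : ℝ} (hm0 : 0 < m) (hm1 : m < 1) {ν : Measure ℝ≥0}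
    (hν : ∀ k : ℕ, ∫⁻ u, (u : ℝ≥0∞) ^ k ∂ν = ENNReal.ofReal ((k ! : ℝ) / qPoch m m k)) :
    0 ∈ interior (integrableExpSet ((↑) : ℝ≥0 → ℝ) ν) := by
  have h1m : 0 < 1 - m := by linarith
  refine mem_interior.2 ⟨Set.Iio ((1 - m) / 2), fun t ht => ?_, isOpen_Iio, ?_⟩
  · refine ⟨by fun_prop, ?_⟩
    refine lt_of_le_of_lt (lintegral_mono fun u => ?_) (lintegral_exp_lt_top_of_moments hm0 hm1 hν)
    rw [Real.enorm_of_nonneg (Real.exp_pos _).le]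
    refine ENNReal.ofReal_le_ofReal (Real.exp_le_exp.2 ?_)
    exact mul_le_mul_of_nonneg_right (le_of_lt ht) u.coe_nonneg
  · simp only [Set.mem_Iio]; positivity

/-- The zeroth moment is the total mass, so uniqueness can be claimed among all Borel measures. -/
theorem isFiniteMeasure_of_moments {m : ℝ} {ν : Measure ℝ≥0}
    (hν : ∀ k : ℕ, ∫⁻ u, (u : ℝ≥0∞) ^ k ∂ν = ENNReal.ofReal ((k ! : ℝ) / qPoch m m k)) :
    IsFiniteMeasure ν := by
  have := hν 0
  simp only [pow_zero, lintegral_one] at this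
  exact ⟨this ▸ ENNReal.ofReal_lt_top⟩

theorem eq_of_moments {m : ℝ} (hm0 : 0 < m) (hm1 : m < 1) {μ ν : Measure ℝ≥0}
    (hμ : ∀ k : ℕ, ∫⁻ u, (u : ℝ≥0∞) ^ k ∂μ = ENNReal.ofReal ((k ! : ℝ) / qPoch m m k))
    (hν : ∀ k : ℕ, ∫⁻ u, (u : ℝ≥0∞) ^ k ∂ν = ENNReal.ofReal ((k ! : ℝ) / qPoch m m k)) :
    ν = μ := by
  have := isFiniteMeasure_of_moments hμ
  have := isFiniteMeasure_of_moments hν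
  have hemb : MeasurableEmbedding ((↑) : ℝ≥0 → ℝ) :=
    MeasurableEmbedding.subtype_coe measurableSet_Ici
  refine hemb.map_injective (map_eq_map_of_moments_eq measurable_coe_nnreal_real
    (zero_mem_interior_integrableExpSet hm0 hm1 hν)
    (zero_mem_interior_integrableExpSet hm0 hm1 hμ) fun n => ?_)
  have hint (ρ : Measure ℝ≥0) :
      ∫ u : ℝ≥0, (u : ℝ) ^ n ∂ρ = (∫⁻ u : ℝ≥0, (u : ℝ≥0∞) ^ n ∂ρ).toReal := by
    rw [integral_eq_lintegral_of_nonneg_ae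
      (Filter.Eventually.of_forall fun u => by positivity) (by fun_prop)]
    congr 1
    refine lintegral_congr fun u => ?_
    rw [ENNReal.ofReal_pow u.coe_nonneg, ENNReal.ofReal_coe_nnreal]
  rw [hint, hint, hμ, hν]

/-! ### The limit law, and transfer of the results to the measures on the half-line. -/

theorem resetProc_ne_top {m : ℝ} (hm0 : 0 < m) (hm1 : m < 1) (t : ℝ) :
    ∀ᵐ ω ∂gapLaw, resetProc m t ω ≠ ∞ := by
  filter_upwards [ae_gapLaw_pos, ae_resetLimit_lt_top hm0 hm1] with ω h1 h2
  exact ((resetProc_le_resetLimit hm0.le h1 t).trans_lt h2).ne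

theorem moment_map_toNNReal {X : (ℕ → ℝ) → ℝ≥0∞} (hX : Measurable X)
    (hfin : ∀ᵐ ω ∂gapLaw, X ω ≠ ∞) (γ : ℝ) :
    moment (gapLaw.map fun ω => (X ω).toNNReal) γ = ∫⁻ ω, X ω ^ γ ∂gapLaw := by
  rw [moment, lintegral_map (by fun_prop) (by fun_prop)]
  refine lintegral_congr_ae ?_
  filter_upwards [hfin] with ω h
  rw [ENNReal.coe_toNNReal h]

/-- The limit law of the measures `muT m t` as `t → ∞`. -/
def limitLaw (m : ℝ) : ProbabilityMeasure ℝ≥0 :=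
  ⟨gapLaw.map fun ω => (resetLimit m ω).toNNReal,
    Measure.isProbabilityMeasure_map (by fun_prop)⟩

theorem moment_limitLaw {m : ℝ} (hm0 : 0 < m) (hm1 : m < 1) (γ : ℝ) :
    moment (limitLaw m : Measure ℝ≥0) γ = ∫⁻ ω, resetLimit m ω ^ γ ∂gapLaw :=
  moment_map_toNNReal (measurable_resetLimit m)
    ((ae_resetLimit_lt_top hm0 hm1).mono fun _ h => h.ne) γ

theorem moment_muT {m : ℝ} (hm0 : 0 < m) (hm1 : m < 1) {t : ℝ} (ht : 0 < t) (γ : ℝ) :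
    moment (muT m t) γ = ∫⁻ ω, resetProc m t ω ^ γ ∂gapLaw := by
  rw [muT_eq_map hm0 hm1 ht]
  exact moment_map_toNNReal (measurable_resetProc m t) (resetProc_ne_top hm0 hm1 t) γ

theorem lintegral_pow_limitLaw {m : ℝ} (hm0 : 0 < m) (hm1 : m < 1) (k : ℕ) :
    ∫⁻ u, (u : ℝ≥0∞) ^ k ∂(limitLaw m : Measure ℝ≥0) =
      ENNReal.ofReal ((k ! : ℝ) / qPoch m m k) := by
  have h := moment_limitLaw hm0 hm1 (k : ℝ)
  simp only [moment, ENNReal.rpow_natCast] at h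
  rw [h, ← limitMoment_natCast hm0 hm1, limitMoment]
  simp only [ENNReal.rpow_natCast]
  have hfin := (lintegral_resetLimit_rpow_lt_top hm0 hm1 (k : ℝ)).ne
  simp only [ENNReal.rpow_natCast] at hfin
  rw [ENNReal.ofReal_toReal hfin]

theorem isProbabilityMeasure_muT {m : ℝ} (hm0 : 0 < m) (hm1 : m < 1) {t : ℝ} (ht : 0 < t) :
    IsProbabilityMeasure (muT m t) := by
  rw [muT_eq_map hm0 hm1 ht]
  exact Measure.isProbabilityMeasure_map (by fun_prop)

/-- All the laws are realized on one space, where convergence is almost sure; bounded convergence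
gives the weak limit. -/
theorem tendsto_lintegral_muT {m : ℝ} (hm0 : 0 < m) (hm1 : m < 1)
    (f : BoundedContinuousFunction ℝ≥0 ℝ≥0) :
    Tendsto (fun t => ∫⁻ u, f u ∂(muT m t)) atTop
      (𝓝 (∫⁻ u, f u ∂(limitLaw m : Measure ℝ≥0))) := by
  have hf : Measurable fun u : ℝ≥0 => (f u : ℝ≥0∞) :=
    (ENNReal.continuous_coe.comp f.continuous).measurable
  have hlim : ∫⁻ u, f u ∂(limitLaw m : Measure ℝ≥0) =
      ∫⁻ ω, f (resetLimit m ω).toNNReal ∂gapLaw := lintegral_map hf (by fun_prop)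
  have hmu : (fun t => ∫⁻ ω, (f (resetProc m t ω).toNNReal : ℝ≥0∞) ∂gapLaw) =ᶠ[atTop]
      fun t => ∫⁻ u, f u ∂(muT m t) := by
    filter_upwards [eventually_gt_atTop 0] with t ht
    rw [muT_eq_map hm0 hm1 ht, lintegral_map hf (by fun_prop)]
  rw [hlim]
  refine Tendsto.congr' hmu ?_
  refine tendsto_lintegral_filter_of_dominated_convergence (fun _ => (nndist f 0 : ℝ≥0∞))
    (Filter.Eventually.of_forall fun t => hf.comp (by fun_prop))
    (Filter.Eventually.of_forall fun t => Filter.Eventually.of_forall fun ω => ?_) (by simp) ?_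
  · exact ENNReal.coe_le_coe.2 (BoundedContinuousFunction.NNReal.upper_bound f _)
  · filter_upwards [ae_gapLaw_pos, ae_resetLimit_lt_top hm0 hm1] with ω h1 h2
    refine ((ENNReal.continuous_coe.comp f.continuous).tendsto _).comp ?_
    exact (ENNReal.tendsto_toNNReal h2.ne).comp (tendsto_resetProc hm0.le h1)

end Resetting

end

theorem mainTheorem6 (c α m : ℝ) (hc₀ : 0 < c) (hc₁ : c < 1) (hα₀ : 0 < α) (hα₂ : α ≤ 2)
    (hm : m = c ^ α) :
    ∃ (hprob : ∀ t : Set.Ioi (0 : ℝ), IsProbabilityMeasure (Resetting.muT m t))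
      (μ : ProbabilityMeasure ℝ≥0),
      -- weak convergence
      Tendsto (β := ProbabilityMeasure ℝ≥0)
        (fun t : Set.Ioi (0 : ℝ) => ⟨Resetting.muT m t, hprob t⟩) atTop (𝓝 μ) ∧
      -- the integer moments of `μ`, and uniqueness among all Borel measures on `[0, ∞)`
      (∀ k : ℕ, ∫⁻ u, (u : ℝ≥0∞) ^ k ∂(μ : Measure ℝ≥0) =
          ENNReal.ofReal ((k ! : ℝ) / Resetting.qPoch m m k)) ∧
      (∀ ν : Measure ℝ≥0,
        (∀ k : ℕ, ∫⁻ u, (u : ℝ≥0∞) ^ k ∂ν =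
          ENNReal.ofReal ((k ! : ℝ) / Resetting.qPoch m m k)) → ν = (μ : Measure ℝ≥0)) ∧
      -- finiteness, convergence and values of all real moments
      (∀ γ : ℝ,
        Resetting.moment (μ : Measure ℝ≥0) γ < ∞ ∧
        Tendsto (fun t : Set.Ioi (0 : ℝ) => Resetting.moment (Resetting.muT m t) γ) atTop
          (𝓝 (Resetting.moment (μ : Measure ℝ≥0) γ)) ∧
        (Resetting.moment (μ : Measure ℝ≥0) γ).toReal =
          Resetting.gammaQuot m γ * (1 - m) ^ (-γ)) := by
  have hm0 : 0 < m := hm ▸ Real.rpow_pos_of_pos hc₀ α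
  have hm1 : m < 1 := hm ▸ Real.rpow_lt_one hc₀.le hc₁ hα₀
  refine ⟨fun t => Resetting.isProbabilityMeasure_muT hm0 hm1 (Set.mem_Ioi.1 t.2), Resetting.limitLaw m, ?_,
    Resetting.lintegral_pow_limitLaw hm0 hm1,
    fun ν hν => Resetting.eq_of_moments hm0 hm1 (Resetting.lintegral_pow_limitLaw hm0 hm1) hν,
    fun γ => ⟨?_, ?_, ?_⟩⟩
  · refine ProbabilityMeasure.tendsto_iff_forall_lintegral_tendsto.2 ?_
    intro f
    exact tendsto_comp_val_Ioi_atTop.2 (Resetting.tendsto_lintegral_muT hm0 hm1 f)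
  · rw [Resetting.moment_limitLaw hm0 hm1]
    exact Resetting.lintegral_resetLimit_rpow_lt_top hm0 hm1 γ
  · rw [Resetting.moment_limitLaw hm0 hm1]
    refine (tendsto_comp_val_Ioi_atTop.2
      (Resetting.tendsto_lintegral_resetProc_rpow hm0 hm1 γ)).congr fun t => ?_
    exact (Resetting.moment_muT hm0 hm1 (Set.mem_Ioi.1 t.2) γ).symm
  · rw [Resetting.moment_limitLaw hm0 hm1]
    exact Resetting.limitMoment_eq_gammaQuot hm0 hm1 γ
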